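/- **Setting.** Let $\mathcal V$ be a commutative unital quantale with multiplication $\otimes$ and unit $k$, which is integral ($k=\top$). Write $r\ll q$ if every $X\subseteq\mathcal V$ with $q\le\bigvee X$ has a finite subset $A$ with $r\le\bigvee A$. Assume that $\mathcal V$ is continuous ($q=\bigvee\{r\mid r\ll q\}$ for all $q$) and let $B\subseteq\mathcal V$ be a basis (for every $q$ the set $\{r\in B\mid r\ll q\}$ is directed with least upper bound $q$) that is closed under finite joins (including $\bot$) and under $\otimes$ and contains $k$. **Calculus.** Given ground types $X\in G$, types are $A::=X\mid I\mid A\otimes A\mid A\multimap A$; let $\Sigma$ be a class of operation symbols $f:A_1,\dots,A_n\to A$ with $n\ge 1$. A context is a list of typed variables in which no variable occurs twice. $\mathrm{Sf}(\Gamma_1;\dots;\Gamma_n)$ is the set of shuffles of $\Gamma_1,\dots,\Gamma_n$, i.e. permutations of the concatenation that keep the relative order of the variables within each $\Gamma_i$. Terms are taken up to renaming of bound variables, and judgements $\Gamma\rhd v:A$ are generated by the following rules, where $E$ is a context, $E\in\mathrm{Sf}(\Gamma;\Delta)$ (in the first rule $E\in\mathrm{Sf}(\Gamma_1;\dots;\Gamma_n)$):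 - if $\Gamma_i\rhd v_i:A_i$ for all $i$ and $f:A_1,\dots,A_n\to A$ is in $\Sigma$, then $E\rhd f(v_1,\dots,v_n):A$; - $x:A\rhd x:A$, and $-\rhd *:I$ (in the empty context); - if $\Gamma\rhd v:A\otimes A'$ and $\Delta,x:A,y:A'\rhd w:C$, then $E\rhd \mathtt{pm}\ v\ \mathtt{to}\ x\otimes y.\,w:C$; - if $\Gamma\rhd v:A$ and $\Delta\rhd w:A'$, then $E\rhd v\otimes w:A\otimes A'$; - if $\Gamma\rhd v:I$ and $\Delta\rhd w:A$, then $E\rhd v\ \mathtt{to}\ *.\,w:A$; - if $\Gamma,x:A\rhd v:A'$, then $\Gamma\rhd\lambda x:A.\,v:A\multimap A'$; - if $\Gamma\rhd v:A\multimap A'$ and $\Delta\rhd w:A$, then $E\rhd v\,w:A'$. A $\mathcal V$-equation-in-context $\Gamma\rhd v=_q w:A$ consists of $q\in B$ and derivable judgements $\Gamma\rhd v:A$ and $\Gamma\rhd w:A$; an equation $\Gamma\rhd v=w:A$ stands for the two $\mathcal V$-equations $\Gamma\rhd v=_\top w:A$ and $\Gamma\rhd w=_\top v:A$. **Deductive system.**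 For a class $Ax$ of $\mathcal V$-equations-in-context, $Th(Ax)$ is the least class of $\mathcal V$-equations-in-context that contains $Ax$ and the following equations (for all well-typed instances, without capture of variables): 1. $\mathtt{pm}\ v\otimes w\ \mathtt{to}\ x\otimes y.\,u=u[v/x,w/y]$, and $\mathtt{pm}\ v\ \mathtt{to}\ x\otimes y.\,u[x\otimes y/z]=u[v/z]$; 2. $*\ \mathtt{to}\ *.\,v=v$, and $v\ \mathtt{to}\ *.\,w[*/z]=w[v/z]$; 3. $(\lambda x:A.\,v)\,w=v[w/x]$, and $\lambda x:A.\,(v\,x)=v$; 4. $u[v\ \mathtt{to}\ *.\,w/z]=v\ \mathtt{to}\ *.\,u[w/z]$, and $u[\mathtt{pm}\ v\ \mathtt{to}\ x\otimes y.\,w/z]=\mathtt{pm}\ v\ \mathtt{to}\ x\otimes y.\,u[w/z]$; and that is closed under the following rules (all labels in $B$): - $v=_\top v$; - $v=_q w$ and $w=_r u$ imply $v=_{q\otimes r}u$; - $v=_q w$ and $r\le q$ imply $v=_r w$; - if $v=_r w$ for all $r\in B$ with $r\ll q$, then $v=_q w$; - if $v=_{q_i}w$ for all $i\le n$ (where $n\geq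 0$), then $v=_{\bigvee_i q_i}w$; - if $v_i=_{q_i}w_i$ for all $i\le n$, then $f(v_1,\dots,v_n)=_{\bigotimes_i q_i}f(w_1,\dots,w_n)$; - if $v=_q w$, then $\lambda x:A.\,v=_q\lambda x:A.\,w$; - if $v=_q w$ and $v'=_r w'$, then $v\otimes v'=_{q\otimes r}w\otimes w'$, $\ v\ \mathtt{to}\ *.\,v'=_{q\otimes r}w\ \mathtt{to}\ *.\,w'$, $\ \mathtt{pm}\ v\ \mathtt{to}\ x\otimes y.\,v'=_{q\otimes r}\mathtt{pm}\ w\ \mathtt{to}\ x\otimes y.\,w'$, $\ v\,v'=_{q\otimes r}w\,w'$ and $v[v'/x]=_{q\otimes r}w[w'/x]$, whenever these terms are well-typed by the corresponding formation rule (for substitution: $\Gamma,x:A\rhd v=_q w:A'$ and $\Delta\rhd v'=_r w':A$ give the conclusion in the context $\Gamma,\Delta$); - if $\Gamma\rhd v=_q w:A$ and $\Delta$ is a permutation of $\Gamma$, then $\Delta\rhd v=_q w:A$. **Semantics.** A $\mathcal V$-category is a set $X$ with $a:X\times X\to\mathcal V$ such that $k\le a(x,x)$ and $a(x,y)\otimes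 a(y,z)\le a(x,z)$; a $\mathcal V$-functor $f:(X,a)\to(Y,b)$ is a map with $a(x,y)\le b(f(x),f(y))$; and $(X,a)\otimes(Y,b)=(X\times Y,a\otimes b)$, where $(a\otimes b)((x,y),(x',y'))=a(x,x')\otimes b(y,y')$. A $\mathcal V\text{-}\mathsf{Cat}$-enriched autonomous category is a symmetric monoidal closed category $\mathsf C$ whose hom-sets are $\mathcal V$-categories such that composition $\mathsf C(X,Y)\otimes\mathsf C(Y,Z)\to\mathsf C(X,Z)$ and the maps $\mathsf C(X,Y)\otimes\mathsf C(X',Y')\to\mathsf C(X\otimes X',Y\otimes Y')$ are $\mathcal V$-functors and the natural bijections $\mathsf C(Y\otimes X,Z)\cong\mathsf C(Y,X\multimap Z)$ are isomorphisms of $\mathcal V$-categories. An interpretation in $\mathsf C$ assigns to each ground type $X\in G$ an object $[\![X]\!]$ (extended to types by the autonomous structure, and to contexts by $[\![x_1:A_1,\dots,x_n:A_n]\!]=(\dots([\![A_1]\!]\otimes[\![A_2]\!])\otimes\dots)\otimes[\![A_n]\!]$, with $[\![-]\!]=I$) and to each $f:A_1,\dots,A_n\to A$ a morphism $[\![A_1]\!]\otimes\dots\otimes[\![A_n]\!]\to[\![A]\!]$.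 By induction on derivations, with the shuffling and splitting isomorphisms $[\![E]\!]\cong[\![\Gamma_1]\!]\otimes\dots\otimes[\![\Gamma_n]\!]$ and the symmetric monoidal closed structure, every derivable judgement is interpreted in the standard way as a morphism $[\![\Gamma\rhd v:A]\!]:[\![\Gamma]\!]\to[\![A]\!]$. The interpretation satisfies $\Gamma\rhd v=_q w:A$ if $q\le a([\![\Gamma\rhd v:A]\!],[\![\Gamma\rhd w:A]\!])$, where $a$ is the $\mathcal V$-category structure of $\mathsf C([\![\Gamma]\!],[\![A]\!])$. **Theorem (soundness).** The equations and rules above are sound for every interpretation in every $\mathcal V\text{-}\mathsf{Cat}$-enriched autonomous category $\mathsf C$: if $\Gamma\rhd v=_q w:A$ results from them alone (that is, it lies in $Th(\emptyset)$), then $\Gamma\rhd v:A$ and $\Gamma\rhd w:A$ are derivable and $$q\le a([\![\Gamma\rhd v:A]\!],[\![\Gamma\rhd w:A]\!]).$$ More generally, for every class $Ax$ of $\mathcal V$-equations-in-context that the interpretation satisfies, it satisfies every element of $Th(Ax)$. -/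

import Mathlib

open CategoryTheory MonoidalCategory

universe u v w t g

/-! ## Quantales: way-below relation, continuity, bases -/

/-- `y` is way-below `x` in a complete lattice. -/
def WayBelow {L : Type t} [CompleteLattice L] (y x : L) : Prop :=
  ∀ X : Set L, x ≤ sSup X → ∃ A : Set L, A ⊆ X ∧ A.Finite ∧ y ≤ sSup A

/-- A complete lattice is continuous if every element is the join of the elements way-below it. -/
def IsContinuousLattice (L : Type t) [CompleteLattice L] : Prop :=
  ∀ x : L, x = sSup {y : L | WayBelow y x}

/-- A basis of a complete lattice: for every `x` the elements of `B` way-below `x` form a directed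
set with least upper bound `x`. -/
def IsLatticeBasis {L : Type t} [CompleteLattice L] (B : Set L) : Prop :=
  ∀ x : L, {y : L | y ∈ B ∧ WayBelow y x}.Nonempty ∧
    DirectedOn (· ≤ ·) {y : L | y ∈ B ∧ WayBelow y x} ∧
    IsLUB {y : L | y ∈ B ∧ WayBelow y x} x

/-- The labels of `V`-equations: a basis that contains the unit and is closed under finite joins
(including the empty one) and under multiplication. -/
structure IsLabelBasis {V : Type t} [CommMonoid V] [CompleteLattice V] (B : Set V) : Prop where
  basis : IsLatticeBasis B
  bot_mem : ⊥ ∈ B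
  sup_mem : ∀ q ∈ B, ∀ r ∈ B, q ⊔ r ∈ B
  mul_mem : ∀ q ∈ B, ∀ r ∈ B, q * r ∈ B
  one_mem : 1 ∈ B

/-! ## `V`-categories and enrichment -/

/-- The structure of a `V`-category on a type `X`. -/
structure VCategory (V : Type t) [CommMonoid V] [CompleteLattice V] (X : Type u) where
  dist : X → X → V
  one_le_dist : ∀ x, 1 ≤ dist x x
  dist_mul_dist : ∀ x y z, dist x y * dist y z ≤ dist x z

namespace VCategory

variable {V : Type t} [CommMonoid V] [CompleteLattice V] {X : Type u} {Y : Type v}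

/-- `f` is a `V`-functor from `(X, a)` to `(Y, b)`. -/
def IsVFunctor (a : VCategory V X) (b : VCategory V Y) (f : X → Y) : Prop :=
  ∀ x x' : X, a.dist x x' ≤ b.dist (f x) (f x')

/-- The tensor product of `V`-categories. -/
def tensor [IsQuantale V] (a : VCategory V X) (b : VCategory V Y) : VCategory V (X × Y) where
  dist p q := a.dist p.1 q.1 * b.dist p.2 q.2
  one_le_dist p := by
    calc (1 : V) = 1 * 1 := (one_mul 1).symm
      _ ≤ _ := mul_le_mul' (a.one_le_dist p.1) (b.one_le_dist p.2)
  dist_mul_dist p q r := by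
    rw [mul_mul_mul_comm]
    exact mul_le_mul' (a.dist_mul_dist _ _ _) (b.dist_mul_dist _ _ _)

end VCategory

section Enrichment

variable (V : Type t) [CommMonoid V] [CompleteLattice V] [IsQuantale V]

/-- A category enriched over `V`-categories: the hom-sets are `V`-categories and composition is a
`V`-functor `C(X,Y) ⊗ C(Y,Z) → C(X,Z)`. -/
class VCatEnriched (C : Type u) [Category.{v} C] where
  hom : ∀ X Y : C, VCategory V (X ⟶ Y)
  comp_isVFunctor : ∀ X Y Z : C,
    ((hom X Y).tensor (hom Y Z)).IsVFunctor (hom X Z)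
      (fun p : (X ⟶ Y) × (Y ⟶ Z) => p.1 ≫ p.2)

/-- The product of two enriched categories, via the tensor product of `V`-categories. -/
instance VCatEnriched.prod (C : Type u) [Category.{v} C] [VCatEnriched V C]
    (D : Type u) [Category.{v} D] [VCatEnriched V D] : VCatEnriched V (C × D) where
  hom X Y := (VCatEnriched.hom X.1 Y.1).tensor (VCatEnriched.hom X.2 Y.2)
  comp_isVFunctor X Y Z := by
    rintro ⟨f, g⟩ ⟨f', g'⟩
    change (_ * _) * (_ * _) ≤ _ * _
    rw [mul_mul_mul_comm]
    exact mul_le_mul'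
      (VCatEnriched.comp_isVFunctor X.1 Y.1 Z.1 (f.1, g.1) (f'.1, g'.1))
      (VCatEnriched.comp_isVFunctor X.2 Y.2 Z.2 (f.2, g.2) (f'.2, g'.2))

/-- A functor between enriched categories is enriched if it acts on hom-sets by `V`-functors. -/
def IsVCatFunctor {C : Type u} [Category.{v} C] [VCatEnriched V C]
    {D : Type u} [Category.{v} D] [VCatEnriched V D] (F : C ⥤ D) : Prop :=
  ∀ X Y : C, (VCatEnriched.hom (V := V) X Y).IsVFunctor (VCatEnriched.hom (F.obj X) (F.obj Y))
    (fun f => F.map f)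

/-- An adjunction `F ⊣ G` between enriched categories is enriched if its natural bijections
`D(F X, Y) ≃ C(X, G Y)` are isomorphisms of `V`-categories. -/
def IsVCatAdjunction {C : Type u} [Category.{v} C] [VCatEnriched V C]
    {D : Type u} [Category.{v} D] [VCatEnriched V D] {F : C ⥤ D} {G : D ⥤ C} (adj : F ⊣ G) :
    Prop :=
  ∀ (X : C) (Y : D),
    (VCatEnriched.hom (V := V) (F.obj X) Y).IsVFunctor (VCatEnriched.hom X (G.obj Y))
      (adj.homEquiv X Y) ∧
    (VCatEnriched.hom (V := V) X (G.obj Y)).IsVFunctor (VCatEnriched.hom (F.obj X) Y)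
      (adj.homEquiv X Y).symm

/-- The adjunction `(- ⊗ X) ⊣ (X ⊸ -)` of a symmetric monoidal closed category. (Mathlib takes
`(X ⊗ -) ⊣ (X ⊸ -)` as the primitive one; the two correspond through the symmetry.) -/
noncomputable def lolliAdjunction {C : Type u} [Category.{v} C] [MonoidalCategory C]
    [SymmetricCategory C] [MonoidalClosed C] (X : C) : tensorRight X ⊣ ihom X :=
  (ihom.adjunction X).ofNatIsoLeft (BraidedCategory.tensorLeftIsoTensorRight X)

/-- An autonomous (symmetric monoidal closed) category `C`, enriched over `V`-categories, is an
enriched autonomous category if the tensor `C × C ⥤ C` is an enriched functor and the adjunctions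
`(- ⊗ X) ⊣ (X ⊸ -)` are enriched. -/
class VCatAutonomous (C : Type u) [Category.{v} C] [MonoidalCategory C] [SymmetricCategory C]
    [MonoidalClosed C] [VCatEnriched V C] : Prop where
  tensor_isVCatFunctor : IsVCatFunctor V (tensor C)
  adjunction_isVCatAdjunction : ∀ X : C, IsVCatAdjunction V (lolliAdjunction X)

end Enrichment

/-! ## Linear lambda-calculus: types, terms, contexts -/

namespace LinLam

/-- Types over a type `G` of ground types. -/
inductive Ty (G : Type u) : Type u where
  | ground : G → Ty G
  | unit : Ty G
  | tensor : Ty G → Ty G → Ty G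
  | lolli : Ty G → Ty G → Ty G

/-- Ground types and sorted operation symbols `f : A₁, …, Aₙ → A` with `n = ar f + 1 ≥ 1`. -/
structure Signature : Type (max (u + 1) (w + 1)) where
  Ground : Type u
  Op : Type w
  ar : Op → ℕ
  dom : (f : Op) → Fin (ar f + 1) → Ty Ground
  cod : Op → Ty Ground

variable {S : Signature.{u, w}}

/-- Variables. -/
abbrev Var := ℕ

/-- Terms up to renaming of bound variables: free variables are named (`fvar`), bound variables are
de Bruijn indices (`bvar`). `lam` binds index `0` of its body, and `pm` binds in its second
argument index `1` (first component) and index `0` (second component). Named binders are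
`Tm.abs` and `Tm.pmTo` below. -/
inductive Tm (S : Signature.{u, w}) : Type (max u w) where
  | bvar : ℕ → Tm S
  | fvar : Var → Tm S
  | op : (f : S.Op) → (Fin (S.ar f + 1) → Tm S) → Tm S
  | star : Tm S
  | toStar : Tm S → Tm S → Tm S
  | tensor : Tm S → Tm S → Tm S
  | pm : Tm S → Tm S → Tm S
  | lam : Ty S.Ground → Tm S → Tm S
  | app : Tm S → Tm S → Tm S

namespace Tm

/-- Replace the free variable `x` by the bound variable with index `k` (counted from outside). -/
def closeAt (x : Var) : ℕ → Tm S → Tm S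
  | _, bvar i => bvar i
  | k, fvar y => if y = x then bvar k else fvar y
  | k, op f a => op f (fun i => closeAt x k (a i))
  | _, star => star
  | k, toStar a b => toStar (closeAt x k a) (closeAt x k b)
  | k, tensor a b => tensor (closeAt x k a) (closeAt x k b)
  | k, pm a b => pm (closeAt x k a) (closeAt x (k + 2) b)
  | k, lam A b => lam A (closeAt x (k + 1) b)
  | k, app a b => app (closeAt x k a) (closeAt x k b)

/-- The term `λ x : A. b`. -/
def abs (x : Var) (A : Ty S.Ground) (b : Tm S) : Tm S := lam A (closeAt x 0 b)

/-- The term `pm a to x ⊗ y. b` (for distinct variables `x`, `y`). -/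
def pmTo (a : Tm S) (x y : Var) (b : Tm S) : Tm S := pm a (closeAt y 0 (closeAt x 1 b))

/-- Simultaneous substitution for the free variables. It is capture-avoiding, since only terms
without dangling indices are ever substituted. -/
def subst (σ : Var → Tm S) : Tm S → Tm S
  | bvar i => bvar i
  | fvar y => σ y
  | op f a => op f (fun i => subst σ (a i))
  | star => star
  | toStar a b => toStar (subst σ a) (subst σ b)
  | tensor a b => tensor (subst σ a) (subst σ b)
  | pm a b => pm (subst σ a) (subst σ b)
  | lam A b => lam A (subst σ b)
  | app a b => app (subst σ a) (subst σ b)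

/-- `b[a/x]` -/
def subst₁ (b : Tm S) (x : Var) (a : Tm S) : Tm S :=
  b.subst (Function.update fvar x a)

/-- `b[a/x, c/y]` (simultaneously, for distinct `x`, `y`) -/
def subst₂ (b : Tm S) (x : Var) (a : Tm S) (y : Var) (c : Tm S) : Tm S :=
  b.subst (Function.update (Function.update fvar x a) y c)

end Tm

/-- Lists of typed variables, written from right to left: the head of the list is the last (that is,
rightmost) variable. Hence `Γ, x : A` is `(x, A) :: Γ`, and `Γ, Δ` is `Δ ++ Γ`. -/
abbrev Ctx (S : Signature.{u, w}) := List (Var × Ty S.Ground)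

/-- The variables of a list of typed variables. -/
def Ctx.names (Γ : Ctx S) : List Var := Γ.map Prod.fst

/-- Typing contexts: no variable occurs twice. -/
def IsCtx (Γ : Ctx S) : Prop := (Ctx.names Γ).Nodup

/-- `Γ₀, Γ₁, …, Γₙ` -/
def Ctx.concat : (n : ℕ) → (Fin (n + 1) → Ctx S) → Ctx S
  | 0, Γs => Γs 0
  | n + 1, Γs => Γs (Fin.last (n + 1)) ++ Ctx.concat n (fun i => Γs i.castSucc)

/-- The shuffles of `Γ` and `Δ`: `Shuffle Γ Δ E` is `E ∈ Sf(Γ; Δ)`. -/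
inductive Shuffle : Ctx S → Ctx S → Ctx S → Type u where
  | nil : Shuffle [] [] []
  | left {Γ Δ E : Ctx S} (a : Var × Ty S.Ground) : Shuffle Γ Δ E → Shuffle (a :: Γ) Δ (a :: E)
  | right {Γ Δ E : Ctx S} (a : Var × Ty S.Ground) : Shuffle Γ Δ E → Shuffle Γ (a :: Δ) (a :: E)

/-- The shuffles of `Γ₀, …, Γₙ`: `MShuffle n Γs E` is `E ∈ Sf(Γ₀; …; Γₙ)`. -/
inductive MShuffle : (n : ℕ) → (Fin (n + 1) → Ctx S) → Ctx S → Type u where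
  | one {Γs : Fin 1 → Ctx S} : MShuffle 0 Γs (Γs 0)
  | snoc {n : ℕ} {Γs : Fin (n + 2) → Ctx S} {E' E : Ctx S} :
      MShuffle n (fun i => Γs i.castSucc) E' → Shuffle E' (Γs (Fin.last (n + 1))) E →
      MShuffle (n + 1) Γs E

/-- `Der Γ v A` is the type of derivations of the judgement `Γ ▷ v : A`. -/
inductive Der : Ctx S → Tm S → Ty S.Ground → Type (max u w) where
  | ax {E : Ctx S} (f : S.Op) {Γs : Fin (S.ar f + 1) → Ctx S} {v : Fin (S.ar f + 1) → Tm S} :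
      (∀ i, Der (Γs i) (v i) (S.dom f i)) → IsCtx E → MShuffle (S.ar f) Γs E →
      Der E (Tm.op f v) (S.cod f)
  | hyp (x : Var) (A : Ty S.Ground) : Der [(x, A)] (Tm.fvar x) A
  | unitI : Der [] Tm.star Ty.unit
  | tensorE {Γ Δ E : Ctx S} {v w : Tm S} {A B C : Ty S.Ground} (x y : Var) :
      Der Γ v (Ty.tensor A B) → Der ((y, B) :: (x, A) :: Δ) w C → IsCtx E → Shuffle Γ Δ E →
      Der E (Tm.pmTo v x y w) C
  | tensorI {Γ Δ E : Ctx S} {v w : Tm S} {A B : Ty S.Ground} :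
      Der Γ v A → Der Δ w B → IsCtx E → Shuffle Γ Δ E →
      Der E (Tm.tensor v w) (Ty.tensor A B)
  | unitE {Γ Δ E : Ctx S} {v w : Tm S} {A : Ty S.Ground} :
      Der Γ v Ty.unit → Der Δ w A → IsCtx E → Shuffle Γ Δ E →
      Der E (Tm.toStar v w) A
  | lolliI {Γ : Ctx S} {v : Tm S} {A B : Ty S.Ground} (x : Var) :
      Der ((x, A) :: Γ) v B → Der Γ (Tm.abs x A v) (Ty.lolli A B)
  | lolliE {Γ Δ E : Ctx S} {v w : Tm S} {A B : Ty S.Ground} :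
      Der Γ v (Ty.lolli A B) → Der Δ w A → IsCtx E → Shuffle Γ Δ E →
      Der E (Tm.app v w) B

/-- The judgement `Γ ▷ v : A` is derivable. -/
def Typed (Γ : Ctx S) (v : Tm S) (A : Ty S.Ground) : Prop := Nonempty (Der Γ v A)

/-! ## Interpretation of judgements in an autonomous category -/

section Semantics

variable {C : Type t} [Category.{v} C] [MonoidalCategory C]

/-- The `n`-fold tensor `(… (X₀ ⊗ X₁) ⊗ …) ⊗ Xₙ`. -/
def tensorObjN : (n : ℕ) → (Fin (n + 1) → C) → C
  | 0, X => X 0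
  | n + 1, X => tensorObjN n (fun i => X i.castSucc) ⊗ X (Fin.last (n + 1))

/-- The `n`-fold tensor of morphisms. -/
def tensorHomN : (n : ℕ) → {X Y : Fin (n + 1) → C} → (∀ i, X i ⟶ Y i) →
    (tensorObjN n X ⟶ tensorObjN n Y)
  | 0, _, _, f => f 0
  | n + 1, _, _, f => tensorHomN n (fun i => f i.castSucc) ⊗ₘ f (Fin.last (n + 1))

variable [SymmetricCategory C] [MonoidalClosed C]

/-- The interpretation of types that extends an interpretation of the ground types. -/
noncomputable def tyObj {G : Type u} (g : G → C) : Ty G → C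
  | Ty.ground X => g X
  | Ty.unit => 𝟙_ C
  | Ty.tensor A B => tyObj g A ⊗ tyObj g B
  | Ty.lolli A B => (ihom (tyObj g A)).obj (tyObj g B)

/-- An interpretation of a signature in an autonomous category: an object for every ground type and
a morphism for every operation symbol. -/
structure Interp (S : Signature.{u, w}) (C : Type t) [Category.{v} C] [MonoidalCategory C]
    [SymmetricCategory C] [MonoidalClosed C] where
  ground : S.Ground → C
  op : (f : S.Op) → (tensorObjN (S.ar f) (fun i => tyObj ground (S.dom f i)) ⟶
    tyObj ground (S.cod f))

namespace Interp

variable (M : Interp S C)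

/-- `⟦A⟧` -/
noncomputable abbrev ty (A : Ty S.Ground) : C := tyObj M.ground A

/-- `⟦Γ⟧` -/
noncomputable def ctx : Ctx S → C
  | [] => 𝟙_ C
  | [a] => M.ty a.2
  | a :: b :: Γ => ctx (b :: Γ) ⊗ M.ty a.2

/-- The isomorphism `sp : ⟦Γ, Δ⟧ ≅ ⟦Γ⟧ ⊗ ⟦Δ⟧`, with inverse `jn`. For empty `Γ` and `Δ` of length at
least two, the last clause gives `α ∘ (λ⁻¹ ⊗ id)`, which is `λ⁻¹` by coherence. -/
noncomputable def sp : (Γ Δ : Ctx S) → (M.ctx (Δ ++ Γ) ≅ M.ctx Γ ⊗ M.ctx Δ)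
  | _, [] => (ρ_ _).symm
  | [], [_] => (λ_ _).symm
  | _ :: _, [_] => Iso.refl _
  | Γ, a :: b :: Δ => whiskerRightIso (sp Γ (b :: Δ)) (M.ty a.2) ≪≫ α_ _ _ _

/-- The morphism `sp : ⟦Γ₀, …, Γₙ⟧ ⟶ ⟦Γ₀⟧ ⊗ … ⊗ ⟦Γₙ⟧`. -/
noncomputable def spN : (n : ℕ) → (Γs : Fin (n + 1) → Ctx S) →
    (M.ctx (Ctx.concat n Γs) ⟶ tensorObjN n (fun i => M.ctx (Γs i)))
  | 0, _ => 𝟙 _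
  | n + 1, Γs => (M.sp (Ctx.concat n (fun i => Γs i.castSucc)) (Γs (Fin.last (n + 1)))).hom ≫
      (spN n (fun i => Γs i.castSucc) ▷ M.ctx (Γs (Fin.last (n + 1))))

/-- Extension of a morphism `⟦Γ⟧ ⟶ ⟦Γ'⟧` by the identity to `⟦Γ, Δ⟧ ⟶ ⟦Γ', Δ⟧`. -/
noncomputable def ext {Γ Γ' : Ctx S} (m : M.ctx Γ ⟶ M.ctx Γ') (Δ : Ctx S) :
    M.ctx (Δ ++ Γ) ⟶ M.ctx (Δ ++ Γ') :=
  (M.sp Γ Δ).hom ≫ (m ▷ M.ctx Δ) ≫ (M.sp Γ' Δ).inv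

/-- The exchange morphism `⟦Γ, a, b, Δ⟧ ⟶ ⟦Γ, b, a, Δ⟧`. -/
noncomputable def exch (Γ : Ctx S) (a b : Var × Ty S.Ground) (Δ : Ctx S) :
    M.ctx (Δ ++ b :: a :: Γ) ⟶ M.ctx (Δ ++ a :: b :: Γ) :=
  (M.sp (b :: a :: Γ) Δ).hom ≫
    (((M.sp Γ [b, a]).hom ≫ (M.ctx Γ ◁ (β_ (M.ty a.2) (M.ty b.2)).hom) ≫
      (M.sp Γ [a, b]).inv) ▷ M.ctx Δ) ≫
    (M.sp (a :: b :: Γ) Δ).inv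

/-- Moving the last variable `a` leftwards over `Δ`, one exchange at a time:
`⟦Γ, Δ, a⟧ ⟶ ⟦Γ, a, Δ⟧`. -/
noncomputable def moveLeft (a : Var × Ty S.Ground) (Γ : Ctx S) : (Δ : Ctx S) →
    (M.ctx (a :: (Δ ++ Γ)) ⟶ M.ctx (Δ ++ a :: Γ))
  | [] => 𝟙 _
  | d :: Δ => M.exch (Δ ++ Γ) d a [] ≫ M.ext (moveLeft a Γ Δ) [d]

/-- The shuffling morphism `sh : ⟦E⟧ ⟶ ⟦Γ, Δ⟧` of a shuffle `E ∈ Sf(Γ; Δ)`. -/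
noncomputable def sh : {Γ Δ E : Ctx S} → Shuffle Γ Δ E → (M.ctx E ⟶ M.ctx (Δ ++ Γ))
  | _, _, _, Shuffle.nil => 𝟙 _
  | _, Δ, _, Shuffle.left (Γ := Γ) a s => M.ext (sh s) [a] ≫ M.moveLeft a Γ Δ
  | _, _, _, Shuffle.right a s => M.ext (sh s) [a]

/-- The shuffling morphism `sh : ⟦E⟧ ⟶ ⟦Γ₀, …, Γₙ⟧` of a shuffle `E ∈ Sf(Γ₀; …; Γₙ)`. -/
noncomputable def shN : {n : ℕ} → {Γs : Fin (n + 1) → Ctx S} → {E : Ctx S} → MShuffle n Γs E →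
    (M.ctx E ⟶ M.ctx (Ctx.concat n Γs))
  | 0, _, _, MShuffle.one => 𝟙 _
  | n + 1, Γs, _, MShuffle.snoc s s' => M.sh s' ≫ M.ext (shN s) (Γs (Fin.last (n + 1)))

end Interp

/-- The interpretation `⟦Γ ▷ v : A⟧ : ⟦Γ⟧ ⟶ ⟦A⟧` of a derived judgement. -/
noncomputable def Der.sem (M : Interp S C) : {Γ : Ctx S} → {v : Tm S} → {A : Ty S.Ground} →
    Der Γ v A → (M.ctx Γ ⟶ M.ty A)
  | _, _, _, Der.ax (Γs := Γs) f d _ s =>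
      M.shN s ≫ M.spN (S.ar f) Γs ≫ tensorHomN (S.ar f) (fun i => (d i).sem M) ≫ M.op f
  | _, _, _, Der.hyp _ _ => 𝟙 _
  | _, _, _, Der.unitI => 𝟙 _
  | _, _, _, Der.tensorE (Γ := Γ) (Δ := Δ) (A := A) (B := B) x y d e _ s =>
      M.sh s ≫ (M.sp Γ Δ).hom ≫ (d.sem M ▷ M.ctx Δ) ≫ (β_ (M.ty A ⊗ M.ty B) (M.ctx Δ)).hom ≫
        (α_ (M.ctx Δ) (M.ty A) (M.ty B)).inv ≫
        ((M.sp Δ [(x, A)]).inv ▷ M.ty B) ≫ (M.sp ((x, A) :: Δ) [(y, B)]).inv ≫ e.sem M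
  | _, _, _, Der.tensorI (Γ := Γ) (Δ := Δ) d e _ s =>
      M.sh s ≫ (M.sp Γ Δ).hom ≫ (d.sem M ⊗ₘ e.sem M)
  | _, _, _, Der.unitE (Γ := Γ) (Δ := Δ) d e _ s =>
      M.sh s ≫ (M.sp Γ Δ).hom ≫ (d.sem M ▷ M.ctx Δ) ≫ (λ_ (M.ctx Δ)).hom ≫ e.sem M
  | _, _, _, Der.lolliI (Γ := Γ) (A := A) (B := B) x d =>
      (lolliAdjunction (M.ty A)).homEquiv (M.ctx Γ) (M.ty B)
        ((M.sp Γ [(x, A)]).inv ≫ d.sem M)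
  | _, _, _, Der.lolliE (Γ := Γ) (Δ := Δ) (A := A) (B := B) d e _ s =>
      M.sh s ≫ (M.sp Γ Δ).hom ≫ (d.sem M ⊗ₘ e.sem M) ≫
        (lolliAdjunction (M.ty A)).counit.app (M.ty B)

/-- The interpretation `M` satisfies the `V`-equation `Γ ▷ v =_q w : A`. -/
def Interp.Satisfies {V : Type*} [CommMonoid V] [CompleteLattice V] [IsQuantale V]
    [VCatEnriched V C] (M : Interp S C) (Γ : Ctx S) (v : Tm S) (q : V) (w : Tm S)
    (A : Ty S.Ground) : Prop :=
  ∀ (d : Der Γ v A) (e : Der Γ w A),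
    q ≤ (VCatEnriched.hom (M.ctx Γ) (M.ty A)).dist (d.sem M) (e.sem M)

end Semantics

/-! ## The deductive system -/

/-- The classical equations-in-context `Γ ▷ v = w : A` of autonomous categories. The context of an
equation is any ordering `E` of the variables of its typed constituents. -/
inductive ClassicalEq : Ctx S → Tm S → Tm S → Ty S.Ground → Prop where
  /-- `pm v ⊗ w to x ⊗ y. u = u[v/x, w/y]` -/
  | tensor_beta {Γ Δ Θ E : Ctx S} {v w u : Tm S} {A B C : Ty S.Ground} {x y : Var} :
      Typed Γ v A → Typed Δ w B → Typed ((y, B) :: (x, A) :: Θ) u C →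
      IsCtx E → E.Perm (Θ ++ Δ ++ Γ) →
      ClassicalEq E (Tm.pmTo (Tm.tensor v w) x y u) (u.subst₂ x v y w) C
  /-- `pm v to x ⊗ y. u[x ⊗ y / z] = u[v/z]` -/
  | tensor_eta {Γ Δ E : Ctx S} {v u : Tm S} {A B C : Ty S.Ground} {x y z : Var} :
      Typed Γ v (Ty.tensor A B) → Typed ((z, Ty.tensor A B) :: Δ) u C →
      x ≠ y → x ∉ Ctx.names Δ → y ∉ Ctx.names Δ →
      IsCtx E → E.Perm (Δ ++ Γ) →
      ClassicalEq E (Tm.pmTo v x y (u.subst₁ z (Tm.tensor (Tm.fvar x) (Tm.fvar y))))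
        (u.subst₁ z v) C
  /-- `∗ to ∗. v = v` -/
  | unit_beta {Γ : Ctx S} {v : Tm S} {A : Ty S.Ground} :
      Typed Γ v A → ClassicalEq Γ (Tm.toStar Tm.star v) v A
  /-- `v to ∗. w[∗/z] = w[v/z]` -/
  | unit_eta {Γ Δ E : Ctx S} {v w : Tm S} {A : Ty S.Ground} {z : Var} :
      Typed Γ v Ty.unit → Typed ((z, Ty.unit) :: Δ) w A →
      IsCtx E → E.Perm (Δ ++ Γ) →
      ClassicalEq E (Tm.toStar v (w.subst₁ z Tm.star)) (w.subst₁ z v) A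
  /-- `(λ x : A. v) w = v[w/x]` -/
  | lolli_beta {Γ Δ E : Ctx S} {v w : Tm S} {A B : Ty S.Ground} {x : Var} :
      Typed ((x, A) :: Γ) v B → Typed Δ w A →
      IsCtx E → E.Perm (Δ ++ Γ) →
      ClassicalEq E (Tm.app (Tm.abs x A v) w) (v.subst₁ x w) B
  /-- `λ x : A. (v x) = v` -/
  | lolli_eta {Γ : Ctx S} {v : Tm S} {A B : Ty S.Ground} {x : Var} :
      Typed Γ v (Ty.lolli A B) → x ∉ Ctx.names Γ →
      ClassicalEq Γ (Tm.abs x A (Tm.app v (Tm.fvar x))) v (Ty.lolli A B)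
  /-- `u[v to ∗. w / z] = v to ∗. u[w/z]` -/
  | unit_comm {Γ Δ Θ E : Ctx S} {u v w : Tm S} {A B : Ty S.Ground} {z : Var} :
      Typed ((z, A) :: Γ) u B → Typed Δ v Ty.unit → Typed Θ w A →
      IsCtx E → E.Perm (Θ ++ Δ ++ Γ) →
      ClassicalEq E (u.subst₁ z (Tm.toStar v w)) (Tm.toStar v (u.subst₁ z w)) B
  /-- `u[pm v to x ⊗ y. w / z] = pm v to x ⊗ y. u[w/z]` -/
  | tensor_comm {Γ Δ Θ E : Ctx S} {u v w : Tm S} {A B C D : Ty S.Ground} {x y z : Var} :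
      Typed ((z, C) :: Γ) u D → Typed Δ v (Ty.tensor A B) →
      Typed ((y, B) :: (x, A) :: Θ) w C →
      x ∉ Ctx.names Γ → y ∉ Ctx.names Γ →
      IsCtx E → E.Perm (Θ ++ Δ ++ Γ) →
      ClassicalEq E (u.subst₁ z (Tm.pmTo v x y w)) (Tm.pmTo v x y (u.subst₁ z w)) D

variable {V : Type t} [CommMonoid V] [CompleteLattice V]

/-- A `V`-equation-in-context `ctx ▷ lhs =_label rhs : ty` with label in `B`. -/
structure VEquation (S : Signature.{u, w}) (B : Set V) where
  ctx : Ctx S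
  lhs : Tm S
  label : V
  rhs : Tm S
  ty : Ty S.Ground
  label_mem : label ∈ B
  lhs_typed : Typed ctx lhs ty
  rhs_typed : Typed ctx rhs ty

/-- `Thm B Ax Γ v q w A`: the `V`-equation `Γ ▷ v =_q w : A` is derivable from the axioms `Ax`, the
classical equations (each of which stands for two `V`-equations with label `⊤`) and the
`V`-congruence rules. -/
inductive Thm (B : Set V) (Ax : Set (VEquation S B)) :
    Ctx S → Tm S → V → Tm S → Ty S.Ground → Prop where
  | axm (e : VEquation S B) : e ∈ Ax → Thm B Ax e.ctx e.lhs e.label e.rhs e.ty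
  | classical {Γ : Ctx S} {v w : Tm S} {A : Ty S.Ground} :
      ClassicalEq Γ v w A → Thm B Ax Γ v ⊤ w A
  | classical_symm {Γ : Ctx S} {v w : Tm S} {A : Ty S.Ground} :
      ClassicalEq Γ v w A → Thm B Ax Γ w ⊤ v A
  | refl {Γ : Ctx S} {v : Tm S} {A : Ty S.Ground} : Typed Γ v A → Thm B Ax Γ v ⊤ v A
  | trans {Γ : Ctx S} {v w u : Tm S} {A : Ty S.Ground} {q r : V} :
      Thm B Ax Γ v q w A → Thm B Ax Γ w r u A → Thm B Ax Γ v (q * r) u A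
  | weak {Γ : Ctx S} {v w : Tm S} {A : Ty S.Ground} {q r : V} :
      Thm B Ax Γ v q w A → r ∈ B → r ≤ q → Thm B Ax Γ v r w A
  | arch {Γ : Ctx S} {v w : Tm S} {A : Ty S.Ground} {q : V} :
      q ∈ B → (∀ r ∈ B, WayBelow r q → Thm B Ax Γ v r w A) → Thm B Ax Γ v q w A
  | join {Γ : Ctx S} {v w : Tm S} {A : Ty S.Ground} {n : ℕ} {q : Fin n → V} :
      Typed Γ v A → Typed Γ w A → (∀ i, Thm B Ax Γ v (q i) w A) → Thm B Ax Γ v (⨆ i, q i) w A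
  | tensorI {Γ Δ E : Ctx S} {v w v' w' : Tm S} {A A' : Ty S.Ground} {q r : V} :
      Thm B Ax Γ v q w A → Thm B Ax Δ v' r w' A' → IsCtx E → Shuffle Γ Δ E →
      Thm B Ax E (Tm.tensor v v') (q * r) (Tm.tensor w w') (Ty.tensor A A')
  | op {E : Ctx S} (f : S.Op) {Γs : Fin (S.ar f + 1) → Ctx S} {v w : Fin (S.ar f + 1) → Tm S}
      {q : Fin (S.ar f + 1) → V} :
      (∀ i, Thm B Ax (Γs i) (v i) (q i) (w i) (S.dom f i)) → IsCtx E →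
      MShuffle (S.ar f) Γs E →
      Thm B Ax E (Tm.op f v) (∏ i, q i) (Tm.op f w) (S.cod f)
  | unitE {Γ Δ E : Ctx S} {v w v' w' : Tm S} {A : Ty S.Ground} {q r : V} :
      Thm B Ax Γ v q w Ty.unit → Thm B Ax Δ v' r w' A → IsCtx E → Shuffle Γ Δ E →
      Thm B Ax E (Tm.toStar v v') (q * r) (Tm.toStar w w') A
  | lolliI {Γ : Ctx S} {v w : Tm S} {A A' : Ty S.Ground} {x : Var} {q : V} :
      Thm B Ax ((x, A) :: Γ) v q w A' →
      Thm B Ax Γ (Tm.abs x A v) q (Tm.abs x A w) (Ty.lolli A A')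
  | tensorE {Γ Δ E : Ctx S} {v w v' w' : Tm S} {A A' C : Ty S.Ground} {x y : Var} {q r : V} :
      Thm B Ax Γ v q w (Ty.tensor A A') → Thm B Ax ((y, A') :: (x, A) :: Δ) v' r w' C →
      IsCtx E → Shuffle Γ Δ E →
      Thm B Ax E (Tm.pmTo v x y v') (q * r) (Tm.pmTo w x y w') C
  | lolliE {Γ Δ E : Ctx S} {v w v' w' : Tm S} {A A' : Ty S.Ground} {q r : V} :
      Thm B Ax Γ v q w (Ty.lolli A A') → Thm B Ax Δ v' r w' A → IsCtx E → Shuffle Γ Δ E →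
      Thm B Ax E (Tm.app v v') (q * r) (Tm.app w w') A'
  | perm {Γ Δ : Ctx S} {v w : Tm S} {A : Ty S.Ground} {q : V} :
      Thm B Ax Γ v q w A → Δ.Perm Γ → Thm B Ax Δ v q w A
  | subst {Γ Δ : Ctx S} {v w v' w' : Tm S} {A A' : Ty S.Ground} {x : Var} {q r : V} :
      Thm B Ax ((x, A) :: Γ) v q w A' → Thm B Ax Δ v' r w' A → IsCtx (Δ ++ Γ) →
      Thm B Ax (Δ ++ Γ) (v.subst₁ x v') (q * r) (w.subst₁ x w') A'

end LinLam

open LinLam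

/-! Semantically every rule is short: each term former is interpreted by an operation on morphisms
that is a `V`-functor in its arguments, and each classical equation is an identity of symmetric
monoidal closed categories. The work lies in the bookkeeping of contexts. A term may have many
derivations, with different splittings, shuffles and names of bound variables, and the two sides of
an equation arise from differently bracketed contexts.

The proof therefore replaces derivations by a relation `Den T t A f` between raw terms and
morphisms. The context `T` is an arbitrarily bracketed tree of named leaves, and in a `Den`
derivation a context may be rearranged by any structural isomorphism (`Can`) before it is split.
Coherence, `Can.unique`, says that two structural isomorphisms between the same trees are equal if
the names are distinct. By linearity the context of a subterm consists exactly of the names that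
occur in it (`Den.mem_names_iff`), so different splittings differ by structural isomorphisms, and
the denotation is unique (`Den.unique`).

Derivations give denotations (`Der.den`), and denotations in contexts without dangling indices give
derivations (`Den.typed`). Hence typing and interpretation can be computed in whatever bracketing is
convenient; `Interp.sound_of_den` is this bridge. The substitution lemma `Den.subst` turns the
substitutions in the equations and rules into compositions. It then remains to check one categorical
identity for each classical equation (`ClassicalEq.exists_den`) and one inequality of distances for
each semantic operation. The final induction carries typability along with the inequality, because
satisfaction quantifies over derivations and would be vacuous if there were none. -/

namespace LinLam

/-! ### Bracketed contexts and structural isomorphisms -/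

/-- Names of the leaves of a context tree: de Bruijn indices and free variables. -/
inductive Name : Type where
  | bound : ℕ → Name
  | free : Var → Name
  deriving DecidableEq

section Trees

variable {S : Signature.{g, w}} {C : Type u} [Category.{v} C] [MonoidalCategory C]
  [SymmetricCategory C] [MonoidalClosed C]

/-- Bracketed contexts, indexed by the object that they denote. -/
inductive CTree (M : Interp S C) : C → Type (max u g) where
  | leaf (n : Name) (A : Ty S.Ground) : CTree M (M.ty A)
  | unit : CTree M (𝟙_ C)
  | tensor {X Y : C} : CTree M X → CTree M Y → CTree M (X ⊗ Y)

variable {M : Interp S C}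

namespace CTree

/-- The leaves of a tree, from left to right. -/
def leaves : {X : C} → CTree M X → List (Name × Ty S.Ground)
  | _, leaf n A => [(n, A)]
  | _, unit => []
  | _, tensor T U => leaves T ++ leaves U

/-- The names of the leaves of a tree. -/
def names {X : C} (T : CTree M X) : List Name := T.leaves.map Prod.fst

@[simp] lemma names_leaf (n : Name) (A : Ty S.Ground) : (leaf (M := M) n A).names = [n] := rfl
@[simp] lemma names_unit : (unit (M := M)).names = [] := rfl
@[simp] lemma names_tensor {X Y : C} (T : CTree M X) (U : CTree M Y) :
    (T.tensor U).names = T.names ++ U.names := by simp [names, leaves]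

/-- Renaming of the leaves. -/
def map (ρ : Name → Name) : {X : C} → CTree M X → CTree M X
  | _, leaf n A => leaf (ρ n) A
  | _, unit => unit
  | _, tensor T U => tensor (map ρ T) (map ρ U)

lemma leaves_map (ρ : Name → Name) {X : C} (T : CTree M X) :
    (T.map ρ).leaves = T.leaves.map (fun p => (ρ p.1, p.2)) := by
  induction T with
  | leaf n A => rfl
  | unit => rfl
  | tensor T U hT hU => simp [map, leaves, hT, hU]

lemma names_map (ρ : Name → Name) {X : C} (T : CTree M X) :
    (T.map ρ).names = T.names.map ρ := by
  simp [names, leaves_map]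

lemma map_congr {ρ ρ' : Name → Name} {X : C} (T : CTree M X) (h : ∀ n ∈ T.names, ρ n = ρ' n) :
    T.map ρ = T.map ρ' := by
  induction T with
  | leaf n A => simp [map, h n (by simp)]
  | unit => rfl
  | tensor T U hT hU =>
    simp [map, hT fun n hn => h n (by simp [hn]), hU fun n hn => h n (by simp [hn])]

lemma map_id {X : C} (T : CTree M X) : T.map (fun n => n) = T := by
  induction T with
  | leaf n A => rfl
  | unit => rfl
  | tensor T U hT hU => simp [map, hT, hU]

lemma map_map (ρ ρ' : Name → Name) {X : C} (T : CTree M X) :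
    (T.map ρ).map ρ' = T.map (fun n => ρ' (ρ n)) := by
  induction T with
  | leaf n A => rfl
  | unit => rfl
  | tensor T U hT hU => simp [map, hT, hU]

end CTree

/-- `Can T U f`: the morphism `f` is composed of the structural isomorphisms of a symmetric monoidal
category, and rearranges the leaves of `T` to those of `U`. -/
inductive Can : {X Y : C} → CTree M X → CTree M Y → (X ⟶ Y) → Prop where
  | refl {X : C} (T : CTree M X) : Can T T (𝟙 X)
  | trans {X Y Z : C} {T : CTree M X} {U : CTree M Y} {W : CTree M Z} {f : X ⟶ Y} {g : Y ⟶ Z} :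
      Can T U f → Can U W g → Can T W (f ≫ g)
  | symm {X Y : C} {T : CTree M X} {U : CTree M Y} (e : X ≅ Y) : Can T U e.hom → Can U T e.inv
  | tensor {X Y X' Y' : C} {T : CTree M X} {U : CTree M Y} {T' : CTree M X'} {U' : CTree M Y'}
      {f : X ⟶ X'} {g : Y ⟶ Y'} : Can T T' f → Can U U' g → Can (T.tensor U) (T'.tensor U') (f ⊗ₘ g)
  | assoc {X Y Z : C} (T : CTree M X) (U : CTree M Y) (W : CTree M Z) :
      Can ((T.tensor U).tensor W) (T.tensor (U.tensor W)) (α_ X Y Z).hom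
  | runit {X : C} (T : CTree M X) : Can (T.tensor CTree.unit) T (ρ_ X).hom
  | braid {X Y : C} (T : CTree M X) (U : CTree M Y) :
      Can (T.tensor U) (U.tensor T) (β_ X Y).hom

namespace Can

variable {X Y Z : C} {T : CTree M X} {U : CTree M Y} {W : CTree M Z}

lemma isIso {f : X ⟶ Y} (h : Can T U f) : IsIso f := by
  induction h with
  | refl => infer_instance
  | trans _ _ h h' => exact IsIso.comp_isIso' h h'
  | symm e => infer_instance
  | tensor _ _ h h' => infer_instance
  | assoc => infer_instance
  | runit => infer_instance
  | braid => infer_instance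

lemma inv {f : X ⟶ Y} [IsIso f] (h : Can T U f) : Can U T (CategoryTheory.inv f) :=
  Can.symm (asIso f) h

lemma symm' {f : X ⟶ Y} (h : Can T U f) : Can U T (@CategoryTheory.inv _ _ _ _ f h.isIso) :=
  have := h.isIso
  h.inv

lemma whiskerRight {f : X ⟶ Y} (h : Can T U f) (W : CTree M Z) :
    Can (T.tensor W) (U.tensor W) (f ▷ Z) := by
  simpa using h.tensor (Can.refl W)

lemma whiskerLeft {f : X ⟶ Y} (W : CTree M Z) (h : Can T U f) :
    Can (W.tensor T) (W.tensor U) (Z ◁ f) := by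
  simpa using (Can.refl W).tensor h

lemma assoc_inv (T : CTree M X) (U : CTree M Y) (W : CTree M Z) :
    Can (T.tensor (U.tensor W)) ((T.tensor U).tensor W) (α_ X Y Z).inv :=
  Can.symm _ (Can.assoc T U W)

lemma runit_inv (T : CTree M X) : Can T (T.tensor CTree.unit) (ρ_ X).inv :=
  Can.symm _ (Can.runit T)

/-- The left unitor need not be a generator: it is the braiding followed by the right unitor. -/
lemma lunit (T : CTree M X) : Can (CTree.unit.tensor T) T (λ_ X).hom := by
  have := (Can.braid CTree.unit T).trans (Can.runit T)
  rwa [braiding_rightUnitor] at this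

lemma lunit_inv (T : CTree M X) : Can T (CTree.unit.tensor T) (λ_ X).inv :=
  Can.symm _ (Can.lunit T)

lemma map (ρ : Name → Name) {f : X ⟶ Y} (h : Can T U f) : Can (T.map ρ) (U.map ρ) f := by
  induction h with
  | refl => exact Can.refl _
  | trans _ _ h h' => exact h.trans h'
  | symm e _ h => exact h.symm e
  | tensor _ _ h h' => exact h.tensor h'
  | assoc => exact Can.assoc _ _ _
  | runit => exact Can.runit _
  | braid => exact Can.braid _ _

/-- Types travel with the names. The converse, that a permutation of the leaves is realised by a
structural morphism, is `Can.exists_of_perm`. -/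
lemma perm {f : X ⟶ Y} (h : Can T U f) : T.leaves.Perm U.leaves := by
  induction h with
  | refl => exact List.Perm.refl _
  | trans _ _ h h' => exact h.trans h'
  | symm e _ h => exact h.symm
  | tensor _ _ h h' => exact h.append h'
  | assoc => simp [CTree.leaves]
  | runit => simp [CTree.leaves]
  | braid => exact List.perm_append_comm

lemma names_perm {f : X ⟶ Y} (h : Can T U f) : T.names.Perm U.names := h.perm.map _

lemma nodup {f : X ⟶ Y} (h : Can T U f) (hT : T.names.Nodup) : U.names.Nodup :=
  h.names_perm.nodup_iff.1 hT

end Can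

/-! ### Coherence -/

namespace CTree

/-- The result of moving one leaf of a tree to its right end. -/
structure Extraction (M : Interp S C) (X : C) where
  obj : C
  ty : Ty S.Ground
  tree : CTree M obj
  iso : X ≅ obj ⊗ M.ty ty

/-- Move the first leaf with name `a` to the right end. -/
noncomputable def extract (a : Name) : {X : C} → CTree M X → Option (Extraction M X)
  | _, leaf n A => if n = a then some ⟨𝟙_ C, A, unit, (λ_ _).symm⟩ else none
  | _, unit => none
  | _, tensor (X := X) (Y := Y) T U =>
    match extract a T with
    -- A leaf found on the left must still cross the whole right factor, hence the braiding; one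
    -- found on the right only needs reassociation.
    | some e => some ⟨e.obj ⊗ Y, e.ty, e.tree.tensor U, whiskerRightIso e.iso Y ≪≫ α_ _ _ _ ≪≫
        whiskerLeftIso _ (β_ _ _) ≪≫ (α_ _ _ _).symm⟩
    | none =>
      match extract a U with
      | some e => some ⟨X ⊗ e.obj, e.ty, T.tensor e.tree,
          whiskerLeftIso X e.iso ≪≫ (α_ _ _ _).symm⟩
      | none => none

lemma extract_eq_none_iff (a : Name) {X : C} (T : CTree M X) :
    T.extract a = none ↔ a ∉ T.names := by
  induction T with
  | leaf n A =>
    by_cases h : n = a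
    · simp [extract, h]
    · simp [extract, h, Ne.symm h]
  | unit => simp [extract]
  | tensor T U hT hU =>
    rw [names_tensor, List.mem_append, not_or, ← hT, ← hU, extract]
    cases T.extract a <;> cases U.extract a <;> simp

lemma perm_of_extract (a : Name) {X : C} (T : CTree M X) {e : Extraction M X}
    (he : T.extract a = some e) : T.leaves.Perm ((a, e.ty) :: e.tree.leaves) := by
  induction T with
  | leaf n A =>
    by_cases h : n = a
    · simp only [extract, h, if_true, Option.some.injEq] at he
      subst he
      simp [leaves, h]
    · simp [extract, h] at he
  | unit => simp [extract] at he
  | tensor T U hT hU =>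
    rw [extract] at he
    rcases h : T.extract a with _ | e'
    · rcases h' : U.extract a with _ | e''
      · simp [h, h'] at he
      · simp only [h, h', Option.some.injEq] at he
        subst he
        exact ((hU h').append_left _).trans List.perm_middle
    · simp only [h, Option.some.injEq] at he
      subst he
      exact (hT h).append_right _

/-- Compatibility of two extractions with a structural morphism. -/
inductive ExtractRel {X Y : C} (c : X ⟶ Y) :
    Option (Extraction M X) → Option (Extraction M Y) → Prop where
  | none : ExtractRel c none none
  | some {A : Ty S.Ground} {X' Y' : C} {T : CTree M X'} {U : CTree M Y'}
      {e : X ≅ X' ⊗ M.ty A} {e' : Y ≅ Y' ⊗ M.ty A} {c' : X' ⟶ Y'} :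
      Can T U c' → c ≫ e'.hom = e.hom ≫ (c' ▷ M.ty A) →
      ExtractRel c (some ⟨X', A, T, e⟩) (some ⟨Y', A, U, e'⟩)

end CTree

-- Extraction of a leaf is natural in structural morphisms: naturality and the coherence axioms
-- settle each generator. Distinctness of names matters at the braiding, since if `a` occurred on
-- both sides, the first occurrences before and after the swap would be different leaves.
open CTree in
lemma Can.extract {X Y : C} {T : CTree M X} {U : CTree M Y} {c : X ⟶ Y} (h : Can T U c)
    (hT : T.names.Nodup) (a : Name) : ExtractRel c (T.extract a) (U.extract a) := by
  induction h with
  | refl T =>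
    rcases T.extract a with _ | ⟨X', A, T', e⟩
    · exact .none
    · exact .some (Can.refl _) (by simp)
  | @trans _ _ _ T U W f g h h' ih ih' =>
    have h1 := ih hT
    have h2 := ih' (h.nodup hT)
    revert h1 h2
    generalize T.extract a = o1
    generalize U.extract a = o2
    generalize W.extract a = o3
    intro h1 h2
    cases h1 with
    | none => cases h2; exact .none
    | some k1 k2 =>
      cases h2 with
      | some k3 k4 => exact .some (k1.trans k3) (by simp [k4, reassoc_of% k2])
  | @symm _ _ T U e h ih =>
    have h1 := ih (h.names_perm.nodup_iff.2 hT)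
    revert h1
    generalize T.extract a = o1
    generalize U.extract a = o2
    intro h1
    cases h1 with
    | none => exact .none
    | some k1 k2 =>
      have := k1.isIso
      refine .some k1.inv ?_
      rw [Iso.inv_comp_eq, reassoc_of% k2]
      simp
  | @tensor X Y X' Y' T U T' U' f g h h' ih ih' =>
    rw [names_tensor] at hT
    have h1 := ih hT.of_append_left
    have h2 := ih' hT.of_append_right
    rw [CTree.extract, CTree.extract]
    revert h1 h2
    generalize T.extract a = o1
    generalize U.extract a = o2
    generalize T'.extract a = o3
    generalize U'.extract a = o4
    intro h1 h2
    cases h1 with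
    | none =>
      cases h2 with
      | none => exact .none
      | some k1 k2 =>
        refine .some (h.tensor k1) ?_
        simp only [Iso.trans_hom, whiskerLeftIso_hom, Iso.symm_hom,
          MonoidalCategory.tensorHom_def f g, MonoidalCategory.tensorHom_def' f, Category.assoc]
        rw [← MonoidalCategory.whiskerLeft_comp_assoc, k2, ← whisker_exchange_assoc]
        simp
    | some k1 k2 =>
      refine .some (k1.tensor h') ?_
      simp only [Iso.trans_hom, whiskerRightIso_hom, whiskerLeftIso_hom, Iso.symm_hom,
        tensorHom_def', Category.assoc, comp_whiskerRight]
      rw [← comp_whiskerRight_assoc, k2]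
      simp only [comp_whiskerRight, Category.assoc, associator_naturality_left_assoc,
        ← whisker_exchange_assoc, associator_inv_naturality_left]
      rw [whisker_exchange_assoc, associator_naturality_right_assoc,
        ← MonoidalCategory.whiskerLeft_comp_assoc, BraidedCategory.braiding_naturality_right,
        MonoidalCategory.whiskerLeft_comp_assoc]
      simp
  | assoc T U W =>
    simp only [CTree.extract]
    rcases T.extract a with _ | ⟨X1, A1, T1, e1⟩
    · rcases U.extract a with _ | ⟨X2, A2, T2, e2⟩
      · rcases W.extract a with _ | ⟨X3, A3, T3, e3⟩
        · exact .none
        · refine .some (Can.assoc _ _ _) ?_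
          simp
      · refine .some (Can.assoc _ _ _) ?_
        simp
    · refine .some (Can.assoc _ _ _) ?_
      simp
  | runit T =>
    simp only [CTree.extract]
    rcases T.extract a with _ | ⟨X1, A1, T1, e1⟩
    · exact .none
    · refine .some (Can.runit _) ?_
      simp
  | @braid X Y T U =>
    rw [names_tensor] at hT
    simp only [CTree.extract]
    have h1 : T.extract a = none ∨ U.extract a = none := by
      rw [extract_eq_none_iff, extract_eq_none_iff]
      by_contra! h
      exact List.disjoint_of_nodup_append hT h.1 h.2
    revert h1
    rcases T.extract a with _ | ⟨X1, A1, T1, e1⟩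
    · rcases U.extract a with _ | ⟨X2, A2, T2, e2⟩
      · exact fun _ => .none
      · refine fun _ => .some (Can.braid _ _) ?_
        -- The extracted leaf crosses `X` once inside the braiding and once more, in the other
        -- direction, in the extraction after it. The two crossings cancel by symmetry; a mere
        -- braiding would not do.
        have h2 : X2 ◁ (β_ X (M.ty A2)).hom ≫ X2 ◁ (β_ (M.ty A2) X).hom = 𝟙 _ := by
          rw [← MonoidalCategory.whiskerLeft_comp, SymmetricCategory.symmetry,
            MonoidalCategory.whiskerLeft_id]
        simp [← BraidedCategory.braiding_naturality_right_assoc, reassoc_of% h2]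
    · rcases U.extract a with _ | ⟨X2, A2, T2, e2⟩
      · refine fun _ => .some (Can.braid _ _) ?_
        simp [← BraidedCategory.braiding_naturality_left_assoc]
      · simp

/-- The canonical isomorphism to the unit of a tree without leaves. -/
def CTree.unitIso : {X : C} → CTree M X → Option (X ≅ 𝟙_ C)
  | _, leaf _ _ => none
  | _, unit => some (Iso.refl _)
  | _, tensor T U => (unitIso T).bind fun e => (unitIso U).map fun e' => (e ⊗ᵢ e') ≪≫ λ_ _

lemma CTree.isSome_unitIso {X : C} (T : CTree M X) (h : T.names = []) :
    ∃ e, T.unitIso = some e := by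
  induction T with
  | leaf n A => simp at h
  | unit => exact ⟨_, rfl⟩
  | tensor T U hT hU =>
    simp only [names_tensor, List.append_eq_nil_iff] at h
    obtain ⟨e, he⟩ := hT h.1
    obtain ⟨e', he'⟩ := hU h.2
    exact ⟨_, by simp [unitIso, he, he']; rfl⟩

/-- Compatibility of two isomorphisms to the unit with a structural morphism. -/
inductive CTree.UnitRel {X Y : C} (c : X ⟶ Y) : Option (X ≅ 𝟙_ C) → Option (Y ≅ 𝟙_ C) → Prop where
  | none : UnitRel c none none
  | some {e : X ≅ 𝟙_ C} {e' : Y ≅ 𝟙_ C} : e.hom = c ≫ e'.hom → UnitRel c (some e) (some e')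

-- The base case of coherence: contraction of a leafless tree to the unit commutes with every
-- generator. For the right unitor and the braiding this rests on the equality of the two unitors at
-- the unit object.
open CTree in
lemma Can.unitIso {X Y : C} {T : CTree M X} {U : CTree M Y} {c : X ⟶ Y} (h : Can T U c) :
    UnitRel c T.unitIso U.unitIso := by
  induction h with
  | refl T =>
    rcases T.unitIso with _ | e
    · exact .none
    · exact .some (by simp)
  | @trans _ _ _ T U W f g h h' ih ih' =>
    revert ih ih'
    generalize T.unitIso = o1
    generalize U.unitIso = o2
    generalize W.unitIso = o3
    intro h1 h2
    cases h1 with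
    | none => cases h2; exact .none
    | some k1 => cases h2 with | some k2 => exact .some (by simp [k1, k2])
  | @symm _ _ T U e h ih =>
    revert ih
    generalize T.unitIso = o1
    generalize U.unitIso = o2
    intro h1
    cases h1 with
    | none => exact .none
    | some k1 => exact .some (by simp [k1])
  | @tensor _ _ _ _ T U T' U' f g h h' ih ih' =>
    rw [CTree.unitIso, CTree.unitIso]
    revert ih ih'
    generalize T.unitIso = o1
    generalize U.unitIso = o2
    generalize T'.unitIso = o3
    generalize U'.unitIso = o4
    intro h1 h2
    cases h1 with
    | none => exact .none
    | some k1 =>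
      cases h2 with
      | none => exact .none
      | some k2 => exact .some (by simp [k1, k2])
  | assoc T U W =>
    simp only [CTree.unitIso]
    rcases T.unitIso with _ | e1
    · exact .none
    rcases U.unitIso with _ | e2
    · exact .none
    rcases W.unitIso with _ | e3
    · exact .none
    refine .some ?_
    simp [MonoidalCategory.tensorHom_def]
  | runit T =>
    simp only [CTree.unitIso]
    rcases T.unitIso with _ | e1
    · exact .none
    refine .some ?_
    simp [MonoidalCategory.tensorHom_def, unitors_equal]
  | braid T U =>
    simp only [CTree.unitIso]
    rcases T.unitIso with _ | e1
    · rcases U.unitIso with _ | e2 <;> exact .none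
    rcases U.unitIso with _ | e2
    · exact .none
    refine .some ?_
    simp only [Iso.trans_hom, tensorIso_hom]
    rw [← BraidedCategory.braiding_naturality_assoc, braiding_leftUnitor, unitors_equal]

/-- Coherence: the structural morphism between trees with distinct names is unique. -/
theorem Can.unique {X Y : C} {T : CTree M X} {U : CTree M Y} {c c' : X ⟶ Y} (h : Can T U c)
    (h' : Can T U c') (hT : T.names.Nodup) : c = c' := by
  obtain ⟨n, hn⟩ : ∃ n, T.leaves.length = n := ⟨_, rfl⟩
  -- Induction on the number of leaves. Leafless trees contract canonically to the unit, and
  -- otherwise one leaf is split off.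
  induction n generalizing X Y with
  | zero =>
    obtain ⟨e, he⟩ := T.isSome_unitIso (by simp [CTree.names, List.length_eq_zero_iff.1 hn])
    have h1 := h.unitIso
    have h2 := h'.unitIso
    rw [he] at h1 h2
    revert h1 h2
    generalize U.unitIso = o
    intro h1 h2
    cases h1 with
    | some k1 =>
      cases h2 with
      | some k2 => rwa [k1, cancel_mono] at k2
  | succ n ih =>
    -- Both morphisms are compared with the same extractions of `a` from `T` and `U`. Up to these
    -- isomorphisms each is a structural morphism of the remaining trees, whiskered with the leaf;
    -- the remainders agree by induction, and the extraction from `U` cancels as a monomorphism.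
    obtain ⟨⟨a, A⟩, l, hl⟩ := List.exists_cons_of_length_eq_add_one hn
    have h1 := h.extract hT a
    have h2 := h'.extract hT a
    have h3 : T.extract a ≠ none := by
      rw [ne_eq, CTree.extract_eq_none_iff, CTree.names, hl]
      simp
    have h4 := @CTree.perm_of_extract _ _ _ _ _ _ M a _ T
    revert h1 h2 h3 h4
    generalize T.extract a = o1
    generalize U.extract a = o2
    intro h1 h2 h3 h4
    cases h1 with
    | none => simp at h3
    | some k1 k2 =>
      cases h2 with
      | some k3 k4 =>
        have h5 := h4 rfl
        have h6 := (h5.map Prod.fst).nodup_iff.1 hT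
        have := ih k1 k3 (List.nodup_cons.1 h6).2 (by simpa [hn] using h5.length_eq.symm)
        rw [this, ← k4, cancel_mono] at k2
        exact k2

/-! ### Left-nested normal forms and realisation of permutations -/

namespace CTree

/-- Left-nested tensor product of a list of leaves; the head of the list is the last leaf. -/
noncomputable def listObj (M : Interp S C) : List (Name × Ty S.Ground) → C
  | [] => 𝟙_ C
  | a :: l => listObj M l ⊗ M.ty a.2

/-- The left-nested tree with a given list of leaves. -/
noncomputable def ofList (M : Interp S C) : (l : List (Name × Ty S.Ground)) → CTree M (listObj M l)
  | [] => unit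
  | a :: l => (ofList M l).tensor (leaf a.1 a.2)

lemma exists_can_append (l l' : List (Name × Ty S.Ground)) :
    ∃ c, Can ((ofList M l').tensor (ofList M l)) (ofList M (l ++ l')) c := by
  induction l with
  | nil => exact ⟨_, Can.runit _⟩
  | cons a l ih =>
    obtain ⟨c, hc⟩ := ih
    exact ⟨_, (Can.assoc_inv _ _ _).trans (hc.tensor (Can.refl _))⟩

lemma exists_can_ofList {X : C} (T : CTree M X) : ∃ c, Can T (ofList M T.leaves) c := by
  induction T with
  | leaf n A => exact ⟨_, Can.lunit_inv _⟩
  | unit => exact ⟨_, Can.refl _⟩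
  | tensor T U hT hU =>
    obtain ⟨c, hc⟩ := hT
    obtain ⟨d, hd⟩ := hU
    obtain ⟨e, he⟩ := exists_can_append (M := M) T.leaves U.leaves
    -- The head of a list is its last leaf in `ofList`, so the order of the two factors is reversed;
    -- the braiding restores it.
    exact ⟨_, ((hc.tensor hd).trans (Can.braid _ _)).trans he⟩

lemma exists_can_of_perm {l l' : List (Name × Ty S.Ground)} (h : l.Perm l') :
    ∃ c, Can (ofList M l) (ofList M l') c := by
  induction h with
  | nil => exact ⟨_, Can.refl _⟩
  | cons a _ ih => exact ⟨_, ih.choose_spec.tensor (Can.refl _)⟩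
  | swap a b l =>
    exact ⟨_, ((Can.assoc _ _ _).trans ((Can.braid _ _).whiskerLeft _)).trans
      (Can.assoc_inv _ _ _)⟩
  | trans _ _ ih ih' => exact ⟨_, ih.choose_spec.trans ih'.choose_spec⟩

end CTree

/-- Both trees reduce to left-nested normal forms, where a permutation is a composite of adjacent
swaps, each realised by the braiding. -/
lemma Can.exists_of_perm {X Y : C} {T : CTree M X} {U : CTree M Y}
    (h : T.leaves.Perm U.leaves) : ∃ c, Can T U c := by
  obtain ⟨c, hc⟩ := T.exists_can_ofList
  obtain ⟨d, hd⟩ := U.exists_can_ofList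
  obtain ⟨e, he⟩ := CTree.exists_can_of_perm (M := M) h
  have := hd.isIso
  exact ⟨_, (hc.trans he).trans hd.inv⟩

end Trees
end LinLam

namespace LinLam

/-! ## Renaming of raw terms -/

namespace Name

/-- Weakening of names under a binder. -/
def shift : Name → Name
  | bound i => bound (i + 1)
  | free x => free x

/-- A renaming, carried under a binder. -/
def lift (ρ : Name → Name) : Name → Name
  | bound 0 => bound 0
  | bound (i + 1) => shift (ρ (bound i))
  | free x => shift (ρ (free x))

lemma shift_injective : Function.Injective shift := by
  rintro (i | x) (j | y) h <;> simp_all [shift]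

lemma shift_ne (n : Name) : shift n ≠ bound 0 := by
  cases n <;> simp [shift]

lemma lift_shift (ρ : Name → Name) (n : Name) : lift ρ (shift n) = shift (ρ n) := by
  cases n <;> rfl

lemma eq_shift_or (n : Name) : n = bound 0 ∨ ∃ m, n = shift m := by
  rcases n with (_ | i) | x
  · exact Or.inl rfl
  · exact Or.inr ⟨bound i, rfl⟩
  · exact Or.inr ⟨free x, rfl⟩

lemma lift_comp (ρ ρ' : Name → Name) :
    lift (fun n => ρ' (ρ n)) = fun n => lift ρ' (lift ρ n) := by
  funext n
  obtain rfl | ⟨m, rfl⟩ := eq_shift_or n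
  · rfl
  · simp only [lift_shift]

lemma lift_id : lift (fun n => n) = fun n => n := by
  funext n
  obtain rfl | ⟨m, rfl⟩ := eq_shift_or n
  · rfl
  · simp only [lift_shift]

/-- Replace the free variable `x` by the index `k`. -/
def close (x : Var) (k : ℕ) : Name → Name
  | bound i => bound i
  | free y => if y = x then bound k else free y

lemma lift_close (x : Var) (k : ℕ) : lift (close x k) = close x (k + 1) := by
  funext n
  rcases n with (_ | i) | y
  · rfl
  · rfl
  · by_cases h : y = x <;> simp [lift, close, h, shift]

end Name

open Name

variable {S : Signature.{g, w}}

namespace Tm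

/-- Names as terms. -/
def ofName : Name → Tm S
  | .bound i => bvar i
  | .free x => fvar x

/-- Renaming of free variables and dangling indices. -/
def ren (ρ : Name → Name) : Tm S → Tm S
  | bvar i => ofName (ρ (.bound i))
  | fvar x => ofName (ρ (.free x))
  | op f a => op f (fun i => ren ρ (a i))
  | star => star
  | toStar a b => toStar (ren ρ a) (ren ρ b)
  | tensor a b => tensor (ren ρ a) (ren ρ b)
  | pm a b => pm (ren ρ a) (ren (lift (lift ρ)) b)
  | lam A b => lam A (ren (lift ρ) b)
  | app a b => app (ren ρ a) (ren ρ b)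

lemma ren_ofName (ρ : Name → Name) (n : Name) : (ofName n : Tm S).ren ρ = ofName (ρ n) := by
  cases n <;> rfl

lemma ren_ren (ρ ρ' : Name → Name) (t : Tm S) :
    (t.ren ρ).ren ρ' = t.ren (fun n => ρ' (ρ n)) := by
  induction t generalizing ρ ρ' <;> simp_all [ren, ren_ofName, lift_comp]

lemma ren_id (t : Tm S) : t.ren (fun n => n) = t := by
  induction t <;> simp_all [ren, ofName, lift_id]

/-- Closing a variable is a renaming, so named binders are covered by the general lemmas on
renaming. -/
lemma closeAt_eq_ren (x : Var) (k : ℕ) (t : Tm S) : closeAt x k t = t.ren (close x k) := by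
  induction t generalizing k with
  | fvar y => by_cases h : y = x <;> simp [closeAt, ren, ofName, close, h]
  | _ => simp_all [closeAt, ren, ofName, close, lift_close]

/-- `occ n t`: the name `n` is a free variable or a dangling index of `t`. -/
def occ : Name → Tm S → Prop
  | n, bvar i => n = .bound i
  | n, fvar x => n = .free x
  | n, op _ a => ∃ i, occ n (a i)
  | _, star => False
  | n, toStar a b => occ n a ∨ occ n b
  | n, tensor a b => occ n a ∨ occ n b
  | n, pm a b => occ n a ∨ occ n.shift.shift b
  | n, lam _ b => occ n.shift b
  | n, app a b => occ n a ∨ occ n b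

lemma ren_congr {ρ ρ' : Name → Name} (t : Tm S) (h : ∀ n, occ n t → ρ n = ρ' n) :
    t.ren ρ = t.ren ρ' := by
  -- Lifted renamings always agree on index `0`, so passing a binder requires agreement on shifted
  -- names only.
  have hl : ∀ {ρ ρ' : Name → Name} {p : Name → Prop}, (∀ n, p n.shift → ρ n = ρ' n) →
      ∀ n, p n → lift ρ n = lift ρ' n := by
    intro ρ ρ' p h n hn
    obtain rfl | ⟨m, rfl⟩ := eq_shift_or n
    · rfl
    · rw [lift_shift, lift_shift, h m hn]
  induction t generalizing ρ ρ' with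
  | bvar i => simp [ren, h _ rfl]
  | fvar x => simp [ren, h _ rfl]
  | op f a ih => simp only [ren]; congr 1; funext i; exact ih i fun n hn => h n ⟨i, hn⟩
  | star => rfl
  | toStar a b iha ihb =>
    simp only [ren]; rw [iha fun n hn => h n (Or.inl hn), ihb fun n hn => h n (Or.inr hn)]
  | tensor a b iha ihb =>
    simp only [ren]; rw [iha fun n hn => h n (Or.inl hn), ihb fun n hn => h n (Or.inr hn)]
  | pm a b iha ihb =>
    simp only [ren]
    rw [iha fun n hn => h n (Or.inl hn), ihb (hl (p := (occ · b)) <|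
      hl (p := fun n => occ n.shift b) fun n hn => h n (Or.inr hn))]
  | lam A b ih => simp only [ren]; rw [ih (hl (p := (occ · b)) h)]
  | app a b iha ihb =>
    simp only [ren]; rw [iha fun n hn => h n (Or.inl hn), ihb fun n hn => h n (Or.inr hn)]

end Tm

/-! ### Context trees under binders, and splittings determined by names -/

section Denotation

variable {C : Type u} [Category.{v} C] [MonoidalCategory C]
  [SymmetricCategory C] [MonoidalClosed C] {M : Interp S C}

namespace CTree

/-- The `n`-fold tensor of trees. -/
noncomputable def tensorN : (n : ℕ) → {X : Fin (n + 1) → C} → (∀ i, CTree M (X i)) →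
    CTree M (tensorObjN n X)
  | 0, _, T => T 0
  | n + 1, _, T => tensor (tensorN n fun i => T i.castSucc) (T (Fin.last (n + 1)))

/-- Extension of a tree by a bound variable. -/
noncomputable def under {X : C} (T : CTree M X) (A : Ty S.Ground) : CTree M (X ⊗ M.ty A) :=
  (T.map shift).tensor (leaf (.bound 0) A)

lemma under_map {X : C} (T : CTree M X) (A : Ty S.Ground) (ρ : Name → Name) :
    (T.under A).map (lift ρ) = (T.map ρ).under A := by
  simp only [under, map, map_map, lift_shift]
  rfl

lemma shift_mem_names_under {X : C} (T : CTree M X) (A : Ty S.Ground) (n : Name) :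
    n.shift ∈ (T.under A).names ↔ n ∈ T.names := by
  simp [under, names_map, shift_injective.eq_iff, shift_ne]

lemma nodup_under {X : C} {T : CTree M X} (h : T.names.Nodup) (A : Ty S.Ground) :
    (T.under A).names.Nodup := by
  rw [under, names_tensor, names_map, names_leaf]
  refine (h.map shift_injective).append (by simp) ?_
  simp [shift_ne]

lemma mem_leaves_tensorN (n : ℕ) {X : Fin (n + 1) → C} (T : ∀ i, CTree M (X i))
    (p : Name × Ty S.Ground) : p ∈ (tensorN n T).leaves ↔ ∃ i, p ∈ (T i).leaves := by
  induction n with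
  | zero => exact ⟨fun h => ⟨0, h⟩, fun ⟨i, h⟩ => by rwa [Fin.fin_one_eq_zero i] at h⟩
  | succ n ih =>
    rw [Fin.exists_fin_succ', ← ih]
    exact List.mem_append

lemma mem_names_tensorN (n : ℕ) {X : Fin (n + 1) → C} (T : ∀ i, CTree M (X i)) (m : Name) :
    m ∈ (tensorN n T).names ↔ ∃ i, m ∈ (T i).names := by
  simp only [names, List.mem_map, mem_leaves_tensorN]
  tauto

lemma nodup_of_tensorN (n : ℕ) {X : Fin (n + 1) → C} (T : ∀ i, CTree M (X i))
    (h : (tensorN n T).names.Nodup) (i : Fin (n + 1)) : (T i).names.Nodup := by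
  induction n with
  | zero => rw [Fin.fin_one_eq_zero i]; exact h
  | succ n ih =>
    have h : (tensor (tensorN n fun i => T i.castSucc) (T (Fin.last (n + 1)))).names.Nodup := h
    rw [names_tensor] at h
    refine Fin.lastCases ?_ (fun j => ?_) i
    · exact h.of_append_right
    · exact ih _ h.of_append_left j

lemma map_tensorN (ρ : Name → Name) (n : ℕ) {X : Fin (n + 1) → C} (T : ∀ i, CTree M (X i)) :
    (tensorN n T).map ρ = tensorN n (fun i => (T i).map ρ) := by
  induction n with
  | zero => rfl
  | succ n ih => simp only [tensorN, map, ih]; rfl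

/-- Inside `W` a name determines its type, as names are distinct there. Two trees with leaves from
`W` and the same names therefore have the same leaves. -/
lemma perm_of_names {X Y Z : C} {T : CTree M X} {U : CTree M Y} {W : CTree M Z}
    (hW : W.names.Nodup) (hT : T.names.Nodup) (hU : U.names.Nodup) (hTW : T.leaves ⊆ W.leaves)
    (hUW : U.leaves ⊆ W.leaves) (h : ∀ n, n ∈ T.names ↔ n ∈ U.names) :
    T.leaves.Perm U.leaves := by
  rw [List.perm_ext_iff_of_nodup hT.of_map hU.of_map]
  have key : ∀ p ∈ W.leaves, ∀ q ∈ W.leaves, p.1 = q.1 → p = q :=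
    fun p hp q hq => List.inj_on_of_nodup_map hW hp hq
  intro p
  constructor
  · intro hp
    obtain ⟨q, hq, hqp⟩ := List.mem_map.1 ((h p.1).1 (List.mem_map_of_mem hp))
    rwa [key p (hTW hp) q (hUW hq) hqp.symm]
  · intro hp
    obtain ⟨q, hq, hqp⟩ := List.mem_map.1 ((h p.1).2 (List.mem_map_of_mem hp))
    rwa [key p (hUW hp) q (hTW hq) hqp.symm]

end CTree

namespace Can

variable {X Y : C} {T : CTree M X} {U : CTree M Y}

lemma under {c : X ⟶ Y} (h : Can T U c) (A : Ty S.Ground) :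
    Can (T.under A) (U.under A) (c ▷ M.ty A) :=
  (h.map shift).whiskerRight _

lemma tensorN (n : ℕ) {X Y : Fin (n + 1) → C} {T : ∀ i, CTree M (X i)} {U : ∀ i, CTree M (Y i)}
    {c : ∀ i, X i ⟶ Y i} (h : ∀ i, Can (T i) (U i) (c i)) :
    Can (CTree.tensorN n T) (CTree.tensorN n U) (tensorHomN n c) := by
  induction n with
  | zero => exact h 0
  | succ n ih => exact (ih fun i => h i.castSucc).tensor (h (Fin.last (n + 1)))

/-- Once the names on either side are prescribed, a splitting of a context is unique up to
structural morphisms of the two halves, and the resulting square commutes by coherence. This makes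
denotations independent of the chosen splittings. -/
lemma split {c : X ⟶ Y} (h : Can T U c) (hT : T.names.Nodup) {X₁ X₂ Y₁ Y₂ : C}
    {T₁ : CTree M X₁} {T₂ : CTree M X₂} {U₁ : CTree M Y₁} {U₂ : CTree M Y₂}
    {k : X ⟶ X₁ ⊗ X₂} {l : Y ⟶ Y₁ ⊗ Y₂} (hk : Can T (T₁.tensor T₂) k)
    (hl : Can U (U₁.tensor U₂) l) (h₁ : ∀ n, n ∈ T₁.names ↔ n ∈ U₁.names)
    (h₂ : ∀ n, n ∈ T₂.names ↔ n ∈ U₂.names) :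
    T₁.names.Nodup ∧ T₂.names.Nodup ∧ ∃ c₁ c₂, Can T₁ U₁ c₁ ∧ Can T₂ U₂ c₂ ∧
      c ≫ l = k ≫ (c₁ ⊗ₘ c₂) := by
  have hT' := hk.nodup hT
  have hU' := (h.trans hl).nodup hT
  have hp := (hk.symm'.trans (h.trans hl)).perm
  rw [CTree.names_tensor] at hT' hU'
  obtain ⟨c₁, hc₁⟩ := Can.exists_of_perm (CTree.perm_of_names (hk.nodup hT) hT'.of_append_left
    hU'.of_append_left (List.subset_append_left _ _)
    (fun p hp' => hp.mem_iff.2 (List.subset_append_left _ _ hp')) h₁)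
  obtain ⟨c₂, hc₂⟩ := Can.exists_of_perm (CTree.perm_of_names (hk.nodup hT) hT'.of_append_right
    hU'.of_append_right (List.subset_append_right _ _)
    (fun p hp' => hp.mem_iff.2 (List.subset_append_right _ _ hp')) h₂)
  exact ⟨hT'.of_append_left, hT'.of_append_right, c₁, c₂, hc₁, hc₂,
    (h.trans hl).unique (hk.trans (hc₁.tensor hc₂)) hT⟩

lemma splitN {c : X ⟶ Y} (h : Can T U c) (hT : T.names.Nodup) {n : ℕ} {X' Y' : Fin (n + 1) → C}
    {T' : ∀ i, CTree M (X' i)} {U' : ∀ i, CTree M (Y' i)}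
    {k : X ⟶ tensorObjN n X'} {l : Y ⟶ tensorObjN n Y'} (hk : Can T (CTree.tensorN n T') k)
    (hl : Can U (CTree.tensorN n U') l) (h' : ∀ i m, m ∈ (T' i).names ↔ m ∈ (U' i).names) :
    (∀ i, (T' i).names.Nodup) ∧ ∃ d : ∀ i, X' i ⟶ Y' i, (∀ i, Can (T' i) (U' i) (d i)) ∧
      c ≫ l = k ≫ tensorHomN n d := by
  have hT' := CTree.nodup_of_tensorN n T' (hk.nodup hT)
  have hU' := CTree.nodup_of_tensorN n U' ((h.trans hl).nodup hT)
  have hp := (hk.symm'.trans (h.trans hl)).perm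
  have key : ∀ i, ∃ d, Can (T' i) (U' i) d := fun i =>
    Can.exists_of_perm (CTree.perm_of_names (hk.nodup hT) (hT' i) (hU' i)
      (fun p hp' => (CTree.mem_leaves_tensorN n T' p).2 ⟨i, hp'⟩)
      (fun p hp' => hp.mem_iff.2 ((CTree.mem_leaves_tensorN n U' p).2 ⟨i, hp'⟩)) (h' i))
  choose d hd using key
  exact ⟨hT', d, hd, (h.trans hl).unique (hk.trans (Can.tensorN n hd)) hT⟩

end Can

/-! The semantic operations of the formation rules. -/

/-- The unit. -/
noncomputable def starTy (M : Interp S C) : 𝟙_ C ⟶ M.ty Ty.unit := 𝟙 (𝟙_ C)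

/-- Pairing. -/
noncomputable def tensorTy {X Y : C} {A B : Ty S.Ground} (f : X ⟶ M.ty A) (h : Y ⟶ M.ty B) :
    X ⊗ Y ⟶ M.ty (Ty.tensor A B) :=
  f ⊗ₘ h

/-- Elimination of the unit. -/
noncomputable def toStarTy {X Y Z : C} (f : X ⟶ M.ty Ty.unit) (h : Y ⟶ Z) : X ⊗ Y ⟶ Z :=
  -- `M.ty Ty.unit` is `𝟙_ C` only by unfolding; naming the codomain explicitly lets the unitor
  -- follow. The same device serves the other type formers.
  MonoidalCategoryStruct.whiskerRight (X₂ := 𝟙_ C) f Y ≫ (λ_ Y).hom ≫ h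

/-- Pattern matching. -/
noncomputable def pmTy {X Y Z : C} {A B : Ty S.Ground} (f : X ⟶ M.ty (Ty.tensor A B))
    (h : (Y ⊗ M.ty A) ⊗ M.ty B ⟶ Z) : X ⊗ Y ⟶ Z :=
  MonoidalCategoryStruct.whiskerRight (X₂ := M.ty A ⊗ M.ty B) f Y ≫
    (β_ (M.ty A ⊗ M.ty B) Y).hom ≫ (α_ Y (M.ty A) (M.ty B)).inv ≫ h

/-- Currying along the adjunction `(- ⊗ A) ⊣ (A ⊸ -)`. -/
noncomputable def curryTy {X : C} {A B : Ty S.Ground} (f : X ⊗ M.ty A ⟶ M.ty B) :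
    X ⟶ M.ty (Ty.lolli A B) :=
  (lolliAdjunction (M.ty A)).homEquiv X (M.ty B) f

/-- Application. -/
noncomputable def appTy {X Y : C} {A B : Ty S.Ground} (f : X ⟶ M.ty (Ty.lolli A B))
    (h : Y ⟶ M.ty A) : X ⊗ Y ⟶ M.ty B :=
  MonoidalCategoryStruct.tensorHom (Y₁ := (ihom (M.ty A)).obj (M.ty B)) f h ≫
    (lolliAdjunction (M.ty A)).counit.app (M.ty B)

/-- Operation symbols. -/
noncomputable def opTy (M : Interp S C) (f : S.Op) {X : Fin (S.ar f + 1) → C}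
    (h : ∀ i, X i ⟶ M.ty (S.dom f i)) : tensorObjN (S.ar f) X ⟶ M.ty (S.cod f) :=
  tensorHomN (S.ar f) h ≫ M.op f

/-! ### Naturality of the semantic operations in the context -/

section Naturality

variable {X Y X' Y' Z : C} {A B : Ty S.Ground} (c : X' ⟶ X) (d : Y' ⟶ Y)

lemma comp_tensorTy (f : X ⟶ M.ty A) (h : Y ⟶ M.ty B) :
    (c ⊗ₘ d) ≫ tensorTy f h = tensorTy (c ≫ f) (d ≫ h) :=
  MonoidalCategory.tensorHom_comp_tensorHom _ _ _ _

lemma comp_toStarTy (f : X ⟶ M.ty Ty.unit) (h : Y ⟶ Z) :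
    (c ⊗ₘ d) ≫ toStarTy f h = toStarTy (c ≫ f) (d ≫ h) := by
  -- The identity is shown with the type of `f` unfolded, where the monoidal rewrite rules match; it
  -- is the goal by definition.
  have key : ∀ f : X ⟶ 𝟙_ C, (c ⊗ₘ d) ≫ f ▷ Y ≫ (λ_ Y).hom ≫ h =
      (c ≫ f) ▷ Y' ≫ (λ_ Y').hom ≫ d ≫ h := by
    intro f
    rw [← leftUnitor_naturality_assoc, ← whisker_exchange_assoc]
    simp [MonoidalCategory.tensorHom_def']
  exact key f

lemma comp_pmTy (f : X ⟶ M.ty (Ty.tensor A B)) (h : (Y ⊗ M.ty A) ⊗ M.ty B ⟶ Z) :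
    (c ⊗ₘ d) ≫ pmTy f h = pmTy (c ≫ f) (d ▷ M.ty A ▷ M.ty B ≫ h) := by
  have key : ∀ f : X ⟶ M.ty A ⊗ M.ty B,
      (c ⊗ₘ d) ≫ f ▷ Y ≫ (β_ (M.ty A ⊗ M.ty B) Y).hom ≫ (α_ Y (M.ty A) (M.ty B)).inv ≫ h =
      (c ≫ f) ▷ Y' ≫ (β_ (M.ty A ⊗ M.ty B) Y').hom ≫ (α_ Y' (M.ty A) (M.ty B)).inv ≫
        d ▷ M.ty A ▷ M.ty B ≫ h := by
    intro f
    rw [← associator_inv_naturality_left_assoc, ← BraidedCategory.braiding_naturality_right_assoc,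
      ← whisker_exchange_assoc]
    simp [MonoidalCategory.tensorHom_def']
  exact key f

lemma comp_curryTy (f : X ⊗ M.ty A ⟶ M.ty B) : c ≫ curryTy f = curryTy (c ▷ M.ty A ≫ f) :=
  ((lolliAdjunction (M.ty A)).homEquiv_naturality_left c f).symm

lemma comp_appTy (f : X ⟶ M.ty (Ty.lolli A B)) (h : Y ⟶ M.ty A) :
    (c ⊗ₘ d) ≫ appTy f h = appTy (c ≫ f) (d ≫ h) := by
  simp only [appTy, ← Category.assoc]
  exact congrArg (· ≫ _) (MonoidalCategory.tensorHom_comp_tensorHom c d _ h)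

omit [SymmetricCategory C] [MonoidalClosed C] in
lemma tensorHomN_comp (n : ℕ) {X Y Z : Fin (n + 1) → C} (f : ∀ i, X i ⟶ Y i)
    (h : ∀ i, Y i ⟶ Z i) :
    tensorHomN n f ≫ tensorHomN n h = tensorHomN n (fun i => f i ≫ h i) := by
  induction n with
  | zero => rfl
  | succ n ih =>
    refine (MonoidalCategory.tensorHom_comp_tensorHom _ _ _ _).trans ?_
    rw [ih]
    rfl

lemma comp_opTy (f : S.Op) {X Y : Fin (S.ar f + 1) → C} (c : ∀ i, X i ⟶ Y i)
    (h : ∀ i, Y i ⟶ M.ty (S.dom f i)) :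
    tensorHomN (S.ar f) c ≫ opTy M f h = opTy M f (fun i => c i ≫ h i) := by
  rw [opTy, opTy, ← Category.assoc, tensorHomN_comp]

end Naturality

/-! ### Denotations of raw terms in bracketed contexts -/

/-- `Den T t A f`: in the context `T` the raw term `t` has type `A` and denotes `f`. -/
inductive Den : {X : C} → CTree M X → Tm S → (A : Ty S.Ground) → (X ⟶ M.ty A) → Prop where
  | bvar {X : C} {T : CTree M X} {i : ℕ} {A : Ty S.Ground} {c : X ⟶ M.ty A} :
      Can T (CTree.leaf (.bound i) A) c → Den T (Tm.bvar i) A c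
  | fvar {X : C} {T : CTree M X} {x : Var} {A : Ty S.Ground} {c : X ⟶ M.ty A} :
      Can T (CTree.leaf (.free x) A) c → Den T (Tm.fvar x) A c
  | op {X : C} {T : CTree M X} (f : S.Op) {Y : Fin (S.ar f + 1) → C} {U : ∀ i, CTree M (Y i)}
      {c : X ⟶ tensorObjN (S.ar f) Y} {a : Fin (S.ar f + 1) → Tm S}
      {h : ∀ i, Y i ⟶ M.ty (S.dom f i)} :
      Can T (CTree.tensorN (S.ar f) U) c → (∀ i, Den (U i) (a i) (S.dom f i) (h i)) →
      Den T (Tm.op f a) (S.cod f) (c ≫ opTy M f h)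
  | star {X : C} {T : CTree M X} {c : X ⟶ 𝟙_ C} :
      Can T CTree.unit c → Den T Tm.star Ty.unit (c ≫ starTy M)
  | toStar {X Y Z : C} {T : CTree M X} {U : CTree M Y} {W : CTree M Z} {c : X ⟶ Y ⊗ Z}
      {a b : Tm S} {A : Ty S.Ground} {f : Y ⟶ M.ty Ty.unit} {h : Z ⟶ M.ty A} :
      Can T (U.tensor W) c → Den U a Ty.unit f → Den W b A h →
      Den T (Tm.toStar a b) A (c ≫ toStarTy f h)
  | tensor {X Y Z : C} {T : CTree M X} {U : CTree M Y} {W : CTree M Z} {c : X ⟶ Y ⊗ Z}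
      {a b : Tm S} {A B : Ty S.Ground} {f : Y ⟶ M.ty A} {h : Z ⟶ M.ty B} :
      Can T (U.tensor W) c → Den U a A f → Den W b B h →
      Den T (Tm.tensor a b) (Ty.tensor A B) (c ≫ tensorTy f h)
  | pm {X Y Z : C} {T : CTree M X} {U : CTree M Y} {W : CTree M Z} {c : X ⟶ Y ⊗ Z}
      {a b : Tm S} {A B D : Ty S.Ground} {f : Y ⟶ M.ty (Ty.tensor A B)}
      {h : (Z ⊗ M.ty A) ⊗ M.ty B ⟶ M.ty D} :
      Can T (U.tensor W) c → Den U a (Ty.tensor A B) f → Den ((W.under A).under B) b D h →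
      Den T (Tm.pm a b) D (c ≫ pmTy f h)
  | lam {X : C} {T : CTree M X} {b : Tm S} {A B : Ty S.Ground} {f : X ⊗ M.ty A ⟶ M.ty B} :
      Den (T.under A) b B f → Den T (Tm.lam A b) (Ty.lolli A B) (curryTy f)
  | app {X Y Z : C} {T : CTree M X} {U : CTree M Y} {W : CTree M Z} {c : X ⟶ Y ⊗ Z}
      {a b : Tm S} {A B : Ty S.Ground} {f : Y ⟶ M.ty (Ty.lolli A B)} {h : Z ⟶ M.ty A} :
      Can T (U.tensor W) c → Den U a (Ty.lolli A B) f → Den W b A h →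
      Den T (Tm.app a b) B (c ≫ appTy f h)

namespace Den

variable {X Y : C} {T : CTree M X} {U : CTree M Y} {t : Tm S} {A : Ty S.Ground}
  {f : X ⟶ M.ty A}

/-- Every constructor except `lam` starts with a free structural morphism, which absorbs `c`; under
`lam` naturality of currying moves it into the body. -/
lemma can (h : Den T t A f) {c : Y ⟶ X} (hc : Can U T c) : Den U t A (c ≫ f) := by
  induction h generalizing Y with
  | bvar h => exact .bvar (hc.trans h)
  | fvar h => exact .fvar (hc.trans h)
  | op f h h' _ => simpa using Den.op f (hc.trans h) h'
  | star h => simpa using Den.star (hc.trans h)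
  | toStar h ha hb _ _ => simpa using Den.toStar (hc.trans h) ha hb
  | tensor h ha hb _ _ => simpa using Den.tensor (hc.trans h) ha hb
  | pm h ha hb _ _ => simpa using Den.pm (hc.trans h) ha hb
  | lam h ih => rw [comp_curryTy]; exact .lam (ih (hc.under _))
  | app h ha hb _ _ => simpa using Den.app (hc.trans h) ha hb

/-- The object of a tree depends only on types, so renaming leaves the morphism unchanged. The
renaming need not be injective, since `Can` is stable under any renaming of leaves. -/
lemma ren (h : Den T t A f) (ρ : Name → Name) : Den (T.map ρ) (t.ren ρ) A f := by
  have key : ∀ {X : C} {T : CTree M X} {n : Name} {A : Ty S.Ground} {c : X ⟶ M.ty A},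
      Can T (.leaf n A) c → Den T (Tm.ofName n) A c := by
    rintro X T (i | x) A c h
    · exact .bvar h
    · exact .fvar h
  induction h generalizing ρ with
  | bvar h => exact key (h.map ρ)
  | fvar h => exact key (h.map ρ)
  | op f h _ ih =>
    have := h.map ρ
    rw [CTree.map_tensorN] at this
    exact .op f this fun i => ih i ρ
  | star h => exact .star (h.map ρ)
  | toStar h _ _ iha ihb => exact .toStar (h.map ρ) (iha ρ) (ihb ρ)
  | tensor h _ _ iha ihb => exact .tensor (h.map ρ) (iha ρ) (ihb ρ)
  | pm h _ _ iha ihb =>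
    have := ihb (lift (lift ρ))
    rw [CTree.under_map, CTree.under_map] at this
    exact .pm (h.map ρ) (iha ρ) this
  | lam _ ih =>
    have := ih (lift ρ)
    rw [CTree.under_map] at this
    exact .lam this
  | app h _ _ iha ihb => exact .app (h.map ρ) (iha ρ) (ihb ρ)

/-- This is linearity: there is no weakening, so each variable of the context is used. In particular
the names on each side of a splitting can be read off the subterms. -/
lemma mem_names_iff (h : Den T t A f) (n : Name) : n ∈ T.names ↔ t.occ n := by
  induction h generalizing n with
  | bvar h => simp [h.names_perm.mem_iff, Tm.occ]
  | fvar h => simp [h.names_perm.mem_iff, Tm.occ]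
  | op f h _ ih => simp [h.names_perm.mem_iff, Tm.occ, CTree.mem_names_tensorN, ih]
  | star h => simp [h.names_perm.mem_iff, Tm.occ]
  | toStar h _ _ iha ihb => simp [h.names_perm.mem_iff, Tm.occ, iha, ihb]
  | tensor h _ _ iha ihb => simp [h.names_perm.mem_iff, Tm.occ, iha, ihb]
  | pm h _ _ iha ihb =>
    simp [h.names_perm.mem_iff, Tm.occ, iha, ← ihb, CTree.shift_mem_names_under]
  | lam _ ih => simp [Tm.occ, ← ih, CTree.shift_mem_names_under]
  | app h _ _ iha ihb => simp [h.names_perm.mem_iff, Tm.occ, iha, ihb]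

lemma mem_names_iff_mem_names {B : Ty S.Ground} {k : Y ⟶ M.ty B} (h : Den T t A f)
    (h' : Den U t B k) (n : Name) : n ∈ T.names ↔ n ∈ U.names := by
  rw [h.mem_names_iff, h'.mem_names_iff]

/-- A term has at most one type and one denotation. -/
theorem unique (h : Den T t A f) (hT : T.names.Nodup) {c : X ⟶ Y} (hc : Can T U c)
    {B : Ty S.Ground} {k : Y ⟶ M.ty B} (h' : Den U t B k) :
    (⟨A, f⟩ : Σ A, X ⟶ M.ty A) = ⟨B, c ≫ k⟩ := by
  -- Type and morphism are compared together: the type of the term does not reveal the argument type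
  -- of an application or the component types of a matched pair, so the induction hypothesis must
  -- identify these types before the morphisms can be compared.
  induction h generalizing Y B with
  | bvar h =>
    cases h' with
    | bvar h' =>
      -- Structural morphisms preserve the types of leaves, which identifies the two types of the
      -- variable.
      have := (h.symm'.trans (hc.trans h')).perm
      simp only [CTree.leaves, List.singleton_perm_singleton, Prod.mk.injEq, true_and] at this
      subst this
      rw [h.unique (hc.trans h') hT]
  | fvar h =>
    cases h' with
    | fvar h' =>
      have := (h.symm'.trans (hc.trans h')).perm
      simp only [CTree.leaves, List.singleton_perm_singleton, Prod.mk.injEq, true_and] at this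
      subst this
      rw [h.unique (hc.trans h') hT]
  | op f h ha ih =>
    cases h' with
    | op _ h' ha' =>
      obtain ⟨hn, d, hd, he⟩ := hc.splitN hT h h' fun i => (ha i).mem_names_iff_mem_names (ha' i)
      have := fun i => eq_of_heq (Sigma.mk.inj_iff.1 (ih i (hn i) (hd i) (ha' i))).2
      rw [reassoc_of% he, comp_opTy]
      congr! 3
      exact funext this
  | star h =>
    cases h' with
    | star h' => rw [h.unique (hc.trans h') hT, Category.assoc]
  | toStar h ha hb iha ihb =>
    cases h' with
    | toStar h' ha' hb' =>
      obtain ⟨h1, h2, d, e, hd, he, hde⟩ := hc.split hT h h' (ha.mem_names_iff_mem_names ha')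
        (hb.mem_names_iff_mem_names hb')
      obtain ⟨-, h3⟩ := Sigma.mk.inj_iff.1 (iha h1 hd ha')
      obtain ⟨⟨⟩, h4⟩ := Sigma.mk.inj_iff.1 (ihb h2 he hb')
      rw [eq_of_heq h3, eq_of_heq h4, reassoc_of% hde, comp_toStarTy]
  | tensor h ha hb iha ihb =>
    cases h' with
    | tensor h' ha' hb' =>
      obtain ⟨h1, h2, d, e, hd, he, hde⟩ := hc.split hT h h' (ha.mem_names_iff_mem_names ha')
        (hb.mem_names_iff_mem_names hb')
      obtain ⟨⟨⟩, h3⟩ := Sigma.mk.inj_iff.1 (iha h1 hd ha')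
      obtain ⟨⟨⟩, h4⟩ := Sigma.mk.inj_iff.1 (ihb h2 he hb')
      rw [eq_of_heq h3, eq_of_heq h4, reassoc_of% hde, comp_tensorTy]
  | pm h ha hb iha ihb =>
    cases h' with
    | pm h' ha' hb' =>
      obtain ⟨h1, h2, d, e, hd, he, hde⟩ := hc.split hT h h' (ha.mem_names_iff_mem_names ha')
        -- The names of the remaining context are recovered from those of the body's context by
        -- shifting past its two binders.
        (fun n => by
          rw [← CTree.shift_mem_names_under, ← CTree.shift_mem_names_under,
            hb.mem_names_iff_mem_names hb', CTree.shift_mem_names_under,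
            CTree.shift_mem_names_under])
      obtain ⟨⟨⟩, h3⟩ := Sigma.mk.inj_iff.1 (iha h1 hd ha')
      obtain ⟨⟨⟩, h4⟩ := Sigma.mk.inj_iff.1
        (ihb (CTree.nodup_under (CTree.nodup_under h2 _) _) ((he.under _).under _) hb')
      rw [eq_of_heq h3, eq_of_heq h4, reassoc_of% hde]
      rw [comp_pmTy]
  | lam h ih =>
    cases h' with
    | lam h' =>
      obtain ⟨⟨⟩, h3⟩ := Sigma.mk.inj_iff.1 (ih (CTree.nodup_under hT _) (hc.under _) h')
      rw [eq_of_heq h3, comp_curryTy]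
  | app h ha hb iha ihb =>
    cases h' with
    | app h' ha' hb' =>
      obtain ⟨h1, h2, d, e, hd, he, hde⟩ := hc.split hT h h' (ha.mem_names_iff_mem_names ha')
        (hb.mem_names_iff_mem_names hb')
      obtain ⟨⟨⟩, h3⟩ := Sigma.mk.inj_iff.1 (iha h1 hd ha')
      obtain ⟨⟨⟩, h4⟩ := Sigma.mk.inj_iff.1 (ihb h2 he hb')
      rw [eq_of_heq h3, eq_of_heq h4, reassoc_of% hde, comp_appTy]

end Den
end Denotation
end LinLam

namespace LinLam
open Name

variable {S : Signature.{g, w}} {C : Type u} [Category.{v} C] [MonoidalCategory C]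
  [SymmetricCategory C] [MonoidalClosed C] {M : Interp S C}

/-! ## Derivations as denotations -/

namespace CTree

/-- A tree without bound variables. -/
def Closed {X : C} (T : CTree M X) : Prop := ∀ i, Name.bound i ∉ T.names

lemma Closed.of_can {X Y : C} {T : CTree M X} {U : CTree M Y} {c : X ⟶ Y} (h : U.Closed)
    (hc : Can T U c) : T.Closed :=
  fun i hi => h i (hc.names_perm.mem_iff.1 hi)

lemma Closed.tensor {X Y : C} {T : CTree M X} {U : CTree M Y} (hT : T.Closed) (hU : U.Closed) :
    (T.tensor U).Closed := fun i => by simp [hT i, hU i]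

lemma closed_leaf (x : Var) (A : Ty S.Ground) : (leaf (M := M) (.free x) A).Closed :=
  fun i => by simp

lemma closed_unit : (unit (M := M)).Closed := fun i => by simp

lemma Closed.map_eq {X : C} {T : CTree M X} (hT : T.Closed) {ρ : Name → Name}
    (h : ∀ x, .free x ∈ T.names → ρ (.free x) = .free x) : T.map ρ = T := by
  refine (T.map_congr fun n hn => ?_).trans T.map_id
  rcases n with i | x
  · exact absurd hn (hT i)
  · exact h x hn

lemma Closed.map_shift {X : C} {T : CTree M X} (hT : T.Closed) : T.map shift = T :=
  hT.map_eq fun _ _ => rfl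

end CTree

namespace Den

variable {X Y Z : C} {T : CTree M X} {U : CTree M Y} {W : CTree M Z}

/-- Closing `x` turns its leaf into index `0` and fixes every other leaf, because `T` has no indices
and does not contain `x`. So the named rule is an instance of the de Bruijn rule. -/
lemma abs {x : Var} {v : Tm S} {A B : Ty S.Ground} {f : X ⊗ M.ty A ⟶ M.ty B}
    (h : Den (T.tensor (.leaf (.free x) A)) v B f) (hT : T.Closed) (hx : .free x ∉ T.names) :
    Den T (Tm.abs x A v) (Ty.lolli A B) (curryTy f) := by
  refine .lam ?_
  have := h.ren (close x 0)
  rw [← Tm.closeAt_eq_ren] at this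
  rw [CTree.under, hT.map_shift]
  rw [CTree.map, CTree.map, hT.map_eq] at this
  · simpa [close] using this
  · intro y hy
    have : y ≠ x := by rintro rfl; exact hx hy
    simp [close, this]

lemma pmTo {x y : Var} {v b : Tm S} {A B D : Ty S.Ground} {f : Y ⟶ M.ty (Ty.tensor A B)}
    {h : (Z ⊗ M.ty A) ⊗ M.ty B ⟶ M.ty D} (hv : Den U v (Ty.tensor A B) f)
    (hb : Den ((W.tensor (.leaf (.free x) A)).tensor (.leaf (.free y) B)) b D h)
    (hW : W.Closed) (hx : .free x ∉ W.names) (hy : .free y ∉ W.names) (hxy : x ≠ y) :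
    Den (U.tensor W) (Tm.pmTo v x y b) D (pmTy f h) := by
  rw [← Category.id_comp (pmTy f h)]
  refine .pm (Can.refl _) hv ?_
  -- The order follows `Tm.pmTo`; the first closing does not touch `y` because `x ≠ y`.
  have := (hb.ren (close x 1)).ren (close y 0)
  rw [← Tm.closeAt_eq_ren, ← Tm.closeAt_eq_ren] at this
  have e : (W.map (close x 1)).map (close y 0) = W := by
    rw [CTree.map_map, hW.map_eq]
    intro z hz
    have h1 : z ≠ x := by rintro rfl; exact hx hz
    have h2 : z ≠ y := by rintro rfl; exact hy hz
    simp [close, h1, h2]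
  have e' : (W.under A).under B =
      (W.tensor (.leaf (.bound 1) A)).tensor (.leaf (.bound 0) B) := by
    rw [CTree.under, CTree.under, CTree.map, hW.map_shift, hW.map_shift]
    rfl
  rw [e']
  simpa only [CTree.map, e, close, hxy.symm, if_true, if_false] using this

/-- This and the following primed lemmas are the constructors for a context that is already split as
required, so that the structural morphism is the identity. -/
lemma toStar' {v b : Tm S} {A : Ty S.Ground} {f : Y ⟶ M.ty Ty.unit} {h : Z ⟶ M.ty A}
    (hv : Den U v Ty.unit f) (hb : Den W b A h) :
    Den (U.tensor W) (Tm.toStar v b) A (toStarTy f h) := by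
  rw [← Category.id_comp (toStarTy f h)]
  exact .toStar (Can.refl _) hv hb

lemma tensor' {v b : Tm S} {A B : Ty S.Ground} {f : Y ⟶ M.ty A} {h : Z ⟶ M.ty B}
    (hv : Den U v A f) (hb : Den W b B h) :
    Den (U.tensor W) (Tm.tensor v b) (Ty.tensor A B) (tensorTy f h) := by
  rw [← Category.id_comp (tensorTy f h)]
  exact .tensor (Can.refl _) hv hb

lemma app' {v b : Tm S} {A B : Ty S.Ground} {f : Y ⟶ M.ty (Ty.lolli A B)} {h : Z ⟶ M.ty A}
    (hv : Den U v (Ty.lolli A B) f) (hb : Den W b A h) :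
    Den (U.tensor W) (Tm.app v b) B (appTy f h) := by
  rw [← Category.id_comp (appTy f h)]
  exact .app (Can.refl _) hv hb

lemma star' : Den (CTree.unit (M := M)) Tm.star Ty.unit (starTy M) := by
  rw [← Category.id_comp (starTy M)]
  exact .star (Can.refl _)

lemma fvar' (x : Var) (A : Ty S.Ground) :
    Den (CTree.leaf (M := M) (.free x) A) (Tm.fvar x) A (𝟙 _) :=
  .fvar (Can.refl _)

end Den

/-! ### Trees of typing contexts -/

/-- A typed variable as a leaf. -/
def toLeaf (a : Var × Ty S.Ground) : Name × Ty S.Ground := (.free a.1, a.2)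

/-- The tree of a context. -/
noncomputable def ctxTree (M : Interp S C) : (Γ : Ctx S) → CTree M (M.ctx Γ)
  | [] => .unit
  | [a] => .leaf (.free a.1) a.2
  | a :: b :: Γ => (ctxTree M (b :: Γ)).tensor (.leaf (.free a.1) a.2)

lemma leaves_ctxTree : (Γ : Ctx S) → (ctxTree M Γ).leaves = (Γ.map toLeaf).reverse
  | [] => rfl
  | [_] => rfl
  | a :: b :: Γ => by
    rw [List.map_cons, List.reverse_cons, ← leaves_ctxTree (b :: Γ)]
    rfl

lemma leaves_ctxTree_perm (Γ : Ctx S) : (ctxTree M Γ).leaves.Perm (Γ.map toLeaf) := by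
  rw [leaves_ctxTree]
  exact List.reverse_perm _

lemma names_ctxTree_perm (Γ : Ctx S) :
    (ctxTree M Γ).names.Perm (Γ.names.map Name.free) := by
  have := (leaves_ctxTree_perm (M := M) Γ).map Prod.fst
  simpa [CTree.names, Ctx.names, toLeaf, Function.comp_def] using this

lemma free_mem_names_ctxTree (Γ : Ctx S) (x : Var) :
    .free x ∈ (ctxTree M Γ).names ↔ x ∈ Γ.names := by
  simp [(names_ctxTree_perm (M := M) Γ).mem_iff]

lemma closed_ctxTree (Γ : Ctx S) : (ctxTree M Γ).Closed := fun i => by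
  simp [(names_ctxTree_perm (M := M) Γ).mem_iff]

lemma nodup_ctxTree {Γ : Ctx S} (h : IsCtx Γ) : (ctxTree M Γ).names.Nodup := by
  rw [(names_ctxTree_perm (M := M) Γ).nodup_iff]
  exact h.map fun _ _ h => Name.free.inj h

/-! ### Splitting and shuffling morphisms are structural -/

namespace Interp

variable (M)

lemma can_sp : (Γ Δ : Ctx S) →
    Can (ctxTree M (Δ ++ Γ)) ((ctxTree M Γ).tensor (ctxTree M Δ)) (M.sp Γ Δ).hom
  | [], [] => Can.runit_inv _
  | _ :: _, [] => Can.runit_inv _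
  | [], [_] => Can.lunit_inv _
  | _ :: _, [_] => Can.refl _
  | [], _ :: b :: Δ => ((can_sp [] (b :: Δ)).whiskerRight _).trans (Can.assoc _ _ _)
  | a :: Γ, _ :: b :: Δ => ((can_sp (a :: Γ) (b :: Δ)).whiskerRight _).trans (Can.assoc _ _ _)

lemma can_sp_inv (Γ Δ : Ctx S) :
    Can ((ctxTree M Γ).tensor (ctxTree M Δ)) (ctxTree M (Δ ++ Γ)) (M.sp Γ Δ).inv :=
  Can.symm _ (M.can_sp Γ Δ)

lemma can_ext {Γ Γ' : Ctx S} {m : M.ctx Γ ⟶ M.ctx Γ'} (h : Can (ctxTree M Γ) (ctxTree M Γ') m)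
    (Δ : Ctx S) : Can (ctxTree M (Δ ++ Γ)) (ctxTree M (Δ ++ Γ')) (M.ext m Δ) :=
  (M.can_sp Γ Δ).trans ((h.whiskerRight _).trans (M.can_sp_inv Γ' Δ))

lemma can_exch (Γ : Ctx S) (a b : Var × Ty S.Ground) (Δ : Ctx S) :
    Can (ctxTree M (Δ ++ b :: a :: Γ)) (ctxTree M (Δ ++ a :: b :: Γ)) (M.exch Γ a b Δ) :=
  (M.can_sp (b :: a :: Γ) Δ).trans (Can.trans (Can.whiskerRight
    ((M.can_sp Γ [b, a]).trans (Can.trans (Can.whiskerLeft _ (Can.braid _ _))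
      (M.can_sp_inv Γ [a, b]))) _) (M.can_sp_inv (a :: b :: Γ) Δ))

lemma can_moveLeft (a : Var × Ty S.Ground) (Γ : Ctx S) : (Δ : Ctx S) →
    Can (ctxTree M (a :: (Δ ++ Γ))) (ctxTree M (Δ ++ a :: Γ)) (M.moveLeft a Γ Δ)
  | [] => Can.refl _
  | d :: Δ => (M.can_exch (Δ ++ Γ) d a []).trans (M.can_ext (can_moveLeft a Γ Δ) [d])

lemma can_sh {Γ Δ E : Ctx S} (s : Shuffle Γ Δ E) :
    Can (ctxTree M E) (ctxTree M (Δ ++ Γ)) (M.sh s) := by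
  induction s with
  | nil => exact Can.refl _
  | @left Γ Δ E a s ih => exact Can.trans (M.can_ext ih [a]) (M.can_moveLeft a Γ Δ :)
  | right a s ih => exact M.can_ext ih [a]

lemma can_shN {n : ℕ} {Γs : Fin (n + 1) → Ctx S} {E : Ctx S} (s : MShuffle n Γs E) :
    Can (ctxTree M E) (ctxTree M (Ctx.concat n Γs)) (M.shN s) := by
  induction s with
  | one => exact Can.refl _
  | snoc s s' ih => exact (M.can_sh s').trans (M.can_ext ih _)

lemma can_spN : (n : ℕ) → (Γs : Fin (n + 1) → Ctx S) →
    Can (ctxTree M (Ctx.concat n Γs)) (CTree.tensorN n fun i => ctxTree M (Γs i)) (M.spN n Γs)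
  | 0, _ => Can.refl _
  | n + 1, Γs => (M.can_sp (Ctx.concat n fun i => Γs i.castSucc) (Γs (Fin.last (n + 1)))).trans
      ((can_spN n fun i => Γs i.castSucc).whiskerRight _)

end Interp

lemma Shuffle.perm {Γ Δ E : Ctx S} (s : Shuffle Γ Δ E) : E.Perm (Δ ++ Γ) := by
  induction s with
  | nil => exact List.Perm.refl _
  | left a s ih => exact (ih.cons a).trans List.perm_middle.symm
  | right a s ih => exact ih.cons a

lemma Der.isCtx {Γ : Ctx S} {v : Tm S} {A : Ty S.Ground} (d : Der Γ v A) : IsCtx Γ := by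
  induction d with
  | ax => assumption
  | hyp x A => simp [IsCtx, Ctx.names]
  | unitI => simp [IsCtx, Ctx.names]
  | tensorE => assumption
  | tensorI => assumption
  | unitE => assumption
  | lolliI x d ih => exact (List.nodup_cons.1 ih).2
  | lolliE => assumption

/-- `⟦Γ⟧ ⊗ ⟦A⟧ ⟶ ⟦Γ, x : A⟧` -/
noncomputable def Interp.snoc (M : Interp S C) (Γ : Ctx S) (x : Var) (A : Ty S.Ground) :
    M.ctx Γ ⊗ M.ty A ⟶ M.ctx ((x, A) :: Γ) :=
  (M.sp Γ [(x, A)]).inv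

lemma Interp.can_snoc (M : Interp S C) (Γ : Ctx S) (x : Var) (A : Ty S.Ground) :
    Can ((ctxTree M Γ).tensor (.leaf (.free x) A)) (ctxTree M ((x, A) :: Γ)) (M.snoc Γ x A) :=
  M.can_sp_inv Γ [(x, A)]

section SemLemmas

variable {Γ Δ E : Ctx S} {v b : Tm S} {A B D : Ty S.Ground}

/-- Here and below the interpretation is regrouped into the shape used by `Den`: at most one
structural morphism, followed by a semantic operation. -/
lemma Der.sem_ax {E : Ctx S} (f : S.Op) {Γs : Fin (S.ar f + 1) → Ctx S}
    {v : Fin (S.ar f + 1) → Tm S} (d : ∀ i, Der (Γs i) (v i) (S.dom f i)) (h : IsCtx E)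
    (s : MShuffle (S.ar f) Γs E) :
    (Der.ax f d h s).sem M =
      (M.shN s ≫ M.spN (S.ar f) Γs) ≫ opTy M f (fun i => (d i).sem M) := by
  rw [Category.assoc]; rfl

lemma Der.sem_tensorE (x y : Var) (d : Der Γ v (Ty.tensor A B))
    (e : Der ((y, B) :: (x, A) :: Δ) b D) (h : IsCtx E) (s : Shuffle Γ Δ E) :
    (Der.tensorE x y d e h s).sem M = (M.sh s ≫ (M.sp Γ Δ).hom) ≫ pmTy (d.sem M)
      (M.snoc Δ x A ▷ M.ty B ≫ M.snoc ((x, A) :: Δ) y B ≫ e.sem M) := by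
  rw [Category.assoc]; rfl

lemma Der.sem_tensorI (d : Der Γ v A) (e : Der Δ b B) (h : IsCtx E) (s : Shuffle Γ Δ E) :
    (Der.tensorI d e h s).sem M = (M.sh s ≫ (M.sp Γ Δ).hom) ≫ tensorTy (d.sem M) (e.sem M) := by
  rw [Category.assoc]; rfl

lemma Der.sem_unitE (d : Der Γ v Ty.unit) (e : Der Δ b A) (h : IsCtx E) (s : Shuffle Γ Δ E) :
    (Der.unitE d e h s).sem M = (M.sh s ≫ (M.sp Γ Δ).hom) ≫ toStarTy (d.sem M) (e.sem M) := by
  rw [Category.assoc]; rfl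

lemma Der.sem_lolliI (x : Var) (d : Der ((x, A) :: Γ) v B) :
    (Der.lolliI x d).sem M = curryTy (M.snoc Γ x A ≫ d.sem M) := rfl

lemma Der.sem_lolliE (d : Der Γ v (Ty.lolli A B)) (e : Der Δ b A) (h : IsCtx E)
    (s : Shuffle Γ Δ E) :
    (Der.lolliE d e h s).sem M = (M.sh s ≫ (M.sp Γ Δ).hom) ≫ appTy (d.sem M) (e.sem M) := by
  rw [Category.assoc]; rfl

end SemLemmas

/-- Shuffles and splittings are structural, so each formation rule is an instance of a `Den`
constructor. With `Den.unique` this makes the interpretation independent of the derivation. -/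
lemma Der.den (M : Interp S C) {Γ : Ctx S} {v : Tm S} {A : Ty S.Ground} (d : Der Γ v A) :
    Den (ctxTree M Γ) v A (d.sem M) := by
  induction d with
  | ax f d h s ih =>
    rw [Der.sem_ax]
    exact .op f ((M.can_shN s).trans (M.can_spN _ _)) ih
  | hyp x A => exact Den.fvar' x A
  | unitI => exact Den.star'
  | @tensorE Γ Δ E v b A B D x y d e h s ihd ihe =>
    have he := e.isCtx
    simp only [IsCtx, Ctx.names, List.map_cons, List.nodup_cons, List.mem_cons, not_or] at he
    rw [Der.sem_tensorE]
    refine (ihd.pmTo ((ihe.can (M.can_snoc _ y B)).can ((M.can_snoc Δ x A).whiskerRight _))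
      (closed_ctxTree _) ?_ ?_ (Ne.symm he.1.1)).can ((M.can_sh s).trans (M.can_sp _ _))
    · rw [free_mem_names_ctxTree]; exact he.2.1
    · rw [free_mem_names_ctxTree]; exact he.1.2
  | tensorI d e h s ihd ihe =>
    rw [Der.sem_tensorI]
    exact (ihd.tensor' ihe).can ((M.can_sh s).trans (M.can_sp _ _))
  | unitE d e h s ihd ihe =>
    rw [Der.sem_unitE]
    exact (ihd.toStar' ihe).can ((M.can_sh s).trans (M.can_sp _ _))
  | @lolliI Γ v A B x d ih =>
    have hx := List.nodup_cons.1 d.isCtx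
    rw [Der.sem_lolliI]
    exact (ih.can (M.can_snoc Γ x A)).abs (closed_ctxTree _)
      (by rw [free_mem_names_ctxTree]; exact hx.1)
  | lolliE d e h s ihd ihe =>
    rw [Der.sem_lolliE]
    exact (ihd.app' ihe).can ((M.can_sh s).trans (M.can_sp _ _))

/-! ## Substitution -/

/-- `DenSub σ T U s`: the substitution `σ` denotes `s`, from the context `U` to the context `T`. -/
def DenSub (σ : Var → Tm S) : {X : C} → CTree M X → {Y : C} → CTree M Y → (Y ⟶ X) → Prop
  | _, .leaf (.bound i) A, _, U, s => Den U (Tm.bvar i) A s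
  -- Closedness of `U` ensures that the substituted term can be carried under binders without
  -- change.
  | _, .leaf (.free x) A, _, U, s => U.Closed ∧ Den U (σ x) A s
  | _, .unit, _, U, s => Can U .unit s
  | _, .tensor (X := X₁) (Y := X₂) T₁ T₂, Y, U, s =>
    ∃ (Y₁ Y₂ : C) (U₁ : CTree M Y₁) (U₂ : CTree M Y₂) (s₁ : Y₁ ⟶ X₁) (s₂ : Y₂ ⟶ X₂)
      (c : Y ⟶ Y₁ ⊗ Y₂), Can U (U₁.tensor U₂) c ∧ DenSub σ T₁ U₁ s₁ ∧ DenSub σ T₂ U₂ s₂ ∧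
        s = c ≫ (s₁ ⊗ₘ s₂)

omit [SymmetricCategory C] [MonoidalClosed C] in
lemma whiskerRight_comp_tensorHom {X₁ X₂ X₃ Y₁ Y₂ : C} (f : X₁ ⟶ X₂) (h : X₂ ⟶ X₃) (k : Y₁ ⟶ Y₂) :
    f ▷ Y₁ ≫ (h ⊗ₘ k) = (f ≫ h) ⊗ₘ k := by
  rw [← tensorHom_id, MonoidalCategory.tensorHom_comp_tensorHom, Category.id_comp]

omit [SymmetricCategory C] [MonoidalClosed C] in
lemma whiskerLeft_comp_tensorHom {X₁ X₂ Y₁ Y₂ Y₃ : C} (k : X₁ ⟶ X₂) (f : Y₁ ⟶ Y₂) (h : Y₂ ⟶ Y₃) :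
    X₁ ◁ f ≫ (k ⊗ₘ h) = k ⊗ₘ (f ≫ h) := by
  rw [← id_tensorHom, MonoidalCategory.tensorHom_comp_tensorHom, Category.id_comp]

namespace DenSub

variable {σ : Var → Tm S} {X Y Z : C} {T : CTree M X} {U : CTree M Y} {s : Y ⟶ X}

lemma can (h : DenSub σ T U s) {W : CTree M Z} {c : Z ⟶ Y} (hc : Can W U c) :
    DenSub σ T W (c ≫ s) := by
  cases T with
  | leaf n A =>
    cases n with
    | bound i => exact Den.can h hc
    | free x => exact ⟨h.1.of_can hc, h.2.can hc⟩
  | unit => exact hc.trans h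
  | tensor T₁ T₂ =>
    obtain ⟨Y₁, Y₂, U₁, U₂, s₁, s₂, d, hd, h₁, h₂, rfl⟩ := h
    exact ⟨Y₁, Y₂, U₁, U₂, s₁, s₂, c ≫ d, hc.trans hd, h₁, h₂, by simp⟩

lemma tensor {X' Y' : C} {T' : CTree M X'} {U' : CTree M Y'} {s' : Y' ⟶ X'}
    (h : DenSub σ T U s) (h' : DenSub σ T' U' s') :
    DenSub σ (T.tensor T') (U.tensor U') (s ⊗ₘ s') :=
  ⟨_, _, U, U', s, s', 𝟙 _, Can.refl _, h, h', by simp⟩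

lemma id (T : CTree M X) (h : ∀ x, .free x ∈ T.names → σ x = Tm.fvar x) :
    DenSub σ T T (𝟙 X) := by
  induction T with
  | leaf n A =>
    cases n with
    | bound i => exact .bvar (Can.refl _)
    | free x => exact ⟨CTree.closed_leaf x A, by rw [h x (by simp)]; exact .fvar (Can.refl _)⟩
  | unit => exact Can.refl _
  | tensor T U hT hU =>
    have := (hT fun x hx => h x (by simp [hx])).tensor (hU fun x hx => h x (by simp [hx]))
    rwa [id_tensorHom_id] at this

/-- Contexts of substituted terms are closed, hence unaffected by the shift; only the pieces that
stand for bound variables are renamed. -/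
lemma shift (h : DenSub σ T U s) : DenSub σ (T.map shift) (U.map shift) s := by
  induction T generalizing Y with
  | leaf n A =>
    cases n with
    | bound i => exact Den.ren h Name.shift
    | free x =>
      refine ⟨?_, ?_⟩ <;> rw [h.1.map_shift]
      exacts [h.1, h.2]
  | unit => exact Can.map _ h
  | tensor T₁ T₂ ih₁ ih₂ =>
    obtain ⟨Y₁, Y₂, U₁, U₂, s₁, s₂, d, hd, h₁, h₂, rfl⟩ := h
    exact ⟨_, _, _, _, _, _, _, hd.map _, ih₁ h₁, ih₂ h₂, rfl⟩

lemma under (h : DenSub σ T U s) (A : Ty S.Ground) :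
    DenSub σ (T.under A) (U.under A) (s ▷ M.ty A) := by
  have := h.shift.tensor (DenSub.id (σ := σ) (CTree.leaf (M := M) (.bound 0) A) (by simp))
  rwa [tensorHom_id] at this

/-- A substitution can be regrouped along any structural rearrangement of its target context, by
rearranging the contexts of the substituted pieces in the same way. The equivalence, rather than one
implication, is what lets the induction pass through inverses. -/
lemma comp_can_iff {X' : C} {T' : CTree M X'} {c : X ⟶ X'} (hc : Can T T' c) {Y : C}
    (U : CTree M Y) (s : Y ⟶ X) : DenSub σ T U s ↔ DenSub σ T' U (s ≫ c) := by
  induction hc generalizing Y with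
  | refl => simp
  | trans _ _ ih ih' => rw [ih, ih', Category.assoc]
  | symm e _ ih => simp [ih]
  | @tensor _ _ _ _ _ _ _ _ f g hf hg ihf ihg =>
    have := hf.isIso
    have := hg.isIso
    constructor
    · rintro ⟨Y₁, Y₂, U₁, U₂, s₁, s₂, d, hd, h₁, h₂, rfl⟩
      exact ⟨_, _, _, _, _, _, d, hd, (ihf _ _).1 h₁, (ihg _ _).1 h₂, by simp⟩
    · rintro ⟨Y₁, Y₂, U₁, U₂, s₁, s₂, d, hd, h₁, h₂, h⟩
      refine ⟨_, _, U₁, U₂, s₁ ≫ CategoryTheory.inv f, s₂ ≫ CategoryTheory.inv g, d, hd,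
        (ihf _ _).2 (by simpa using h₁), (ihg _ _).2 (by simpa using h₂), ?_⟩
      rw [← cancel_mono (f ⊗ₘ g), h]
      simp
  | assoc T₁ T₂ T₃ =>
    constructor
    · rintro ⟨Y', Y₃, U', U₃, s', s₃, d, hd, ⟨Y₁, Y₂, U₁, U₂, s₁, s₂, e, he, h₁, h₂, rfl⟩, h₃, rfl⟩
      refine ⟨_, _, U₁, _, s₁, _, _, hd.trans ((he.whiskerRight U₃).trans (Can.assoc _ _ _)), h₁,
        h₂.tensor h₃, ?_⟩
      rw [← whiskerRight_comp_tensorHom]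
      simp
    · rintro ⟨Y₁, Y', U₁, U', s₁, s', d, hd, h₁, ⟨Y₂, Y₃, U₂, U₃, s₂, s₃, e, he, h₂, h₃, rfl⟩, h⟩
      refine ⟨_, _, _, U₃, _, s₃, _, hd.trans ((he.whiskerLeft U₁).trans (Can.assoc_inv _ _ _)),
        h₁.tensor h₂, h₃, ?_⟩
      rw [← cancel_mono (α_ _ _ _).hom, h, ← whiskerLeft_comp_tensorHom]
      simp
  | runit T =>
    constructor
    · rintro ⟨Y₁, Y₂, U₁, U₂, s₁, s₂, d, hd, h₁, h₂, rfl⟩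
      have := h₁.can (hd.trans ((Can.whiskerLeft U₁ h₂).trans (Can.runit _)))
      convert this using 1
      simp [MonoidalCategory.tensorHom_def']
    · intro h
      refine ⟨_, _, U, .unit, s ≫ (ρ_ _).hom, 𝟙 _, (ρ_ _).inv, Can.runit_inv _, h, Can.refl _, ?_⟩
      simp
  | braid T₁ T₂ =>
    constructor
    · rintro ⟨Y₁, Y₂, U₁, U₂, s₁, s₂, d, hd, h₁, h₂, rfl⟩
      exact ⟨_, _, _, _, _, _, _, hd.trans (Can.braid _ _), h₂, h₁, by simp⟩
    · rintro ⟨Y₁, Y₂, U₁, U₂, s₁, s₂, d, hd, h₁, h₂, h⟩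
      refine ⟨_, _, _, _, _, _, _, hd.trans (Can.braid _ _), h₂, h₁, ?_⟩
      rw [← cancel_mono (β_ _ _).hom, h]
      simp

lemma tensorN (n : ℕ) {X : Fin (n + 1) → C} {T : ∀ i, CTree M (X i)} {Y : C} {U : CTree M Y}
    {s : Y ⟶ tensorObjN n X} (h : DenSub σ (CTree.tensorN n T) U s) :
    ∃ F : ∀ i, Σ Z : C, CTree M Z × (Z ⟶ X i),
      (∀ i, DenSub σ (T i) (F i).2.1 (F i).2.2) ∧
      ∃ c, Can U (CTree.tensorN n fun i => (F i).2.1) c ∧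
        s = c ≫ tensorHomN n (fun i => (F i).2.2) := by
  induction n generalizing Y with
  | zero =>
    -- `F` is kept opaque apart from its value at `0`: rewriting with that equation replaces object,
    -- tree and morphism together, without casts.
    obtain ⟨F, hF⟩ : ∃ F : ∀ i, Σ Z : C, CTree M Z × (Z ⟶ X i), F 0 = ⟨Y, U, s⟩ :=
      ⟨fun i => by rw [Fin.fin_one_eq_zero i]; exact ⟨Y, U, s⟩, rfl⟩
    refine ⟨F, fun i => ?_, ?_⟩
    · obtain rfl := Fin.fin_one_eq_zero i
      rw [hF]
      exact h
    · change ∃ c : Y ⟶ (F 0).1, Can U (F 0).2.1 c ∧ s = c ≫ (F 0).2.2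
      rw [hF]
      exact ⟨𝟙 _, Can.refl _, (Category.id_comp s).symm⟩
  | succ n ih =>
    obtain ⟨Y₁, Y₂, U₁, U₂, s₁, s₂, d, hd, h₁, h₂, rfl⟩ := h
    obtain ⟨F', hF', c, hc, rfl⟩ := ih h₁
    obtain ⟨F, rfl, hF⟩ : ∃ F : ∀ i, Σ Z : C, CTree M Z × (Z ⟶ X i),
        F' = (fun i : Fin (n + 1) => F i.castSucc) ∧ F (Fin.last (n + 1)) = ⟨Y₂, U₂, s₂⟩ :=
      ⟨fun i => Fin.lastCases (motive := fun i => Σ Z : C, CTree M Z × (Z ⟶ X i))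
        ⟨Y₂, U₂, s₂⟩ F' i, by simp, by simp⟩
    have hF₂ : DenSub σ (T (Fin.last (n + 1))) (F (Fin.last (n + 1))).2.1
        (F (Fin.last (n + 1))).2.2 := by
      rw [hF]
      exact h₂
    refine ⟨F, Fin.lastCases hF₂ hF', ?_⟩
    change ∃ e : Y ⟶ tensorObjN n (fun i => (F i.castSucc).1) ⊗ (F (Fin.last (n + 1))).1,
      Can U ((CTree.tensorN n fun i => (F i.castSucc).2.1).tensor (F (Fin.last (n + 1))).2.1) e ∧
        _ = e ≫ (tensorHomN n (fun i => (F i.castSucc).2.2) ⊗ₘ (F (Fin.last (n + 1))).2.2)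
    rw [hF]
    exact ⟨_, hd.trans (hc.whiskerRight _), by rw [← whiskerRight_comp_tensorHom]; simp⟩

end DenSub

/-- The substitution lemma. -/
theorem Den.subst {σ : Var → Tm S} {X Y : C} {T : CTree M X} {U : CTree M Y} {t : Tm S}
    {A : Ty S.Ground} {f : X ⟶ M.ty A} {s : Y ⟶ X} (h : Den T t A f) (hs : DenSub σ T U s) :
    Den U (t.subst σ) A (s ≫ f) := by
  induction h generalizing Y with
  | bvar h => exact (DenSub.comp_can_iff h _ _).1 hs
  | fvar h => exact ((DenSub.comp_can_iff h _ _).1 hs).2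
  | op f h _ ih =>
    -- The substitution is first transported along `h` to the split context, where it decomposes
    -- into substitutions for the arguments.
    obtain ⟨F, hF, c, hc, he⟩ := DenSub.tensorN _ ((DenSub.comp_can_iff h _ _).1 hs)
    rw [reassoc_of% he, comp_opTy]
    exact .op f hc fun i => ih i (hF i)
  | star h =>
    rw [← Category.assoc]
    exact .star ((DenSub.comp_can_iff h _ _).1 hs)
  | toStar h _ _ iha ihb =>
    obtain ⟨_, _, _, _, _, _, d, hd, h₁, h₂, he⟩ := (DenSub.comp_can_iff h _ _).1 hs
    rw [reassoc_of% he, comp_toStarTy]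
    exact .toStar hd (iha h₁) (ihb h₂)
  | tensor h _ _ iha ihb =>
    obtain ⟨_, _, _, _, _, _, d, hd, h₁, h₂, he⟩ := (DenSub.comp_can_iff h _ _).1 hs
    rw [reassoc_of% he, comp_tensorTy]
    exact .tensor hd (iha h₁) (ihb h₂)
  | pm h _ _ iha ihb =>
    obtain ⟨_, _, _, _, _, _, d, hd, h₁, h₂, he⟩ := (DenSub.comp_can_iff h _ _).1 hs
    rw [reassoc_of% he, comp_pmTy]
    exact .pm hd (iha h₁) (ihb ((h₂.under _).under _))
  | lam _ ih =>
    rw [comp_curryTy]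
    exact .lam (ih (hs.under _))
  | app h _ _ iha ihb =>
    obtain ⟨_, _, _, _, _, _, d, hd, h₁, h₂, he⟩ := (DenSub.comp_can_iff h _ _).1 hs
    rw [reassoc_of% he, comp_appTy]
    exact .app hd (iha h₁) (ihb h₂)

/-- Apply the substitution lemma to the identity on `T`, where `x` does not occur, tensored with `a`
at the leaf `x`. -/
lemma Den.subst₁ {X Y : C} {T : CTree M X} {U : CTree M Y} {a b : Tm S} {x : Var}
    {A B : Ty S.Ground} {f : X ⊗ M.ty A ⟶ M.ty B} {k : Y ⟶ M.ty A}
    (h : Den (T.tensor (.leaf (.free x) A)) b B f) (hx : .free x ∉ T.names)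
    (ha : Den U a A k) (hU : U.Closed) :
    Den (T.tensor U) (b.subst₁ x a) B (X ◁ k ≫ f) := by
  rw [← id_tensorHom]
  refine h.subst (DenSub.tensor (DenSub.id _ ?_) ⟨hU, by simpa using ha⟩)
  intro y hy
  exact Function.update_of_ne (by rintro rfl; exact hx hy) _ _

lemma Den.subst₂ {X Y Z : C} {T : CTree M X} {U : CTree M Y} {W : CTree M Z} {a b d : Tm S}
    {x y : Var} {A B D : Ty S.Ground} {f : (X ⊗ M.ty A) ⊗ M.ty D ⟶ M.ty B} {k : Y ⟶ M.ty A}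
    {l : Z ⟶ M.ty D}
    (h : Den ((T.tensor (.leaf (.free x) A)).tensor (.leaf (.free y) D)) b B f)
    (hx : .free x ∉ T.names) (hy : .free y ∉ T.names) (hxy : x ≠ y)
    (ha : Den U a A k) (hU : U.Closed) (hd : Den W d D l) (hW : W.Closed) :
    Den ((T.tensor U).tensor W) (b.subst₂ x a y d) B (((X ◁ k) ⊗ₘ l) ≫ f) := by
  rw [← id_tensorHom]
  refine h.subst (DenSub.tensor (DenSub.tensor (DenSub.id _ ?_) ⟨hU, ?_⟩) ⟨hW, by simpa using hd⟩)
  · intro z hz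
    rw [Function.update_of_ne (by rintro rfl; exact hy hz),
      Function.update_of_ne (by rintro rfl; exact hx hz)]
  · simpa [Function.update_of_ne hxy] using ha

end LinLam

namespace LinLam
open Name

variable {S : Signature.{g, w}} {C : Type u} [Category.{v} C] [MonoidalCategory C]
  [SymmetricCategory C] [MonoidalClosed C] {M : Interp S C}

/-! ## Typability of denoted terms -/

namespace Name

/-- Instantiate the innermost bound variable by `x`, and the others by `ρ`. -/
def cons (x : Var) (ρ : Name → Name) : Name → Name
  | bound 0 => free x
  | bound (i + 1) => ρ (bound i)
  | free y => ρ (free y)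

lemma cons_shift (x : Var) (ρ : Name → Name) (n : Name) : cons x ρ n.shift = ρ n := by
  cases n <;> rfl

end Name

/-- Used to open a binder: the innermost bound leaf becomes a named variable, as the typing rules
require. -/
lemma CTree.map_cons_under {X : C} (T : CTree M X) (A : Ty S.Ground) (x : Var)
    (ρ : Name → Name) :
    (T.under A).map (Name.cons x ρ) = (T.map ρ).tensor (.leaf (.free x) A) := by
  simp only [CTree.under, CTree.map, CTree.map_map, Name.cons_shift]
  rfl

/-- Walk through `Γ` and send each variable to a side that still contains it; the order within each
side is then inherited from `Γ`. -/
lemma exists_shuffle {Γ : Ctx S} {L₁ L₂ : List (Name × Ty S.Ground)}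
    (h : (Γ.map toLeaf).Perm (L₁ ++ L₂)) :
    ∃ Γ₁ Γ₂, Nonempty (Shuffle Γ₁ Γ₂ Γ) ∧ (Γ₁.map toLeaf).Perm L₁ ∧ (Γ₂.map toLeaf).Perm L₂ := by
  classical
  induction Γ generalizing L₁ L₂ with
  | nil =>
    have := h.symm.eq_nil
    rw [List.append_eq_nil_iff] at this
    obtain ⟨rfl, rfl⟩ := this
    exact ⟨[], [], ⟨.nil⟩, .refl _, .refl _⟩
  | cons a Γ ih =>
    rw [List.map_cons] at h
    rcases List.mem_append.1 (h.subset List.mem_cons_self) with ha | ha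
    · have h₁ := List.perm_cons_erase ha
      obtain ⟨Γ₁, Γ₂, ⟨s⟩, k₁, k₂⟩ := ih (List.Perm.cons_inv (h.trans (h₁.append_right L₂)))
      exact ⟨a :: Γ₁, Γ₂, ⟨.left a s⟩, (k₁.cons _).trans h₁.symm, k₂⟩
    · have h₂ := List.perm_cons_erase ha
      obtain ⟨Γ₁, Γ₂, ⟨s⟩, k₁, k₂⟩ := ih (List.Perm.cons_inv
        (h.trans ((h₂.append_left L₁).trans List.perm_middle)))
      exact ⟨Γ₁, a :: Γ₂, ⟨.right a s⟩, k₁, (k₂.cons _).trans h₂.symm⟩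

lemma exists_mshuffle (n : ℕ) {Γ : Ctx S} {X : Fin (n + 1) → C} (T : ∀ i, CTree M (X i))
    (h : (Γ.map toLeaf).Perm (CTree.tensorN n T).leaves) :
    ∃ Γs : Fin (n + 1) → Ctx S, Nonempty (MShuffle n Γs Γ) ∧
      ∀ i, ((Γs i).map toLeaf).Perm (T i).leaves := by
  induction n generalizing Γ with
  | zero =>
    refine ⟨fun _ => Γ, ⟨.one⟩, fun i => ?_⟩
    obtain rfl := Fin.fin_one_eq_zero i
    exact h
  | succ n ih =>
    obtain ⟨Γ₁, Γ₂, ⟨s⟩, h₁, h₂⟩ := exists_shuffle h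
    obtain ⟨Γs, ⟨s'⟩, hs⟩ := ih _ h₁
    obtain ⟨Δs, rfl, rfl⟩ : ∃ Δs : Fin (n + 2) → Ctx S,
        Γs = (fun i : Fin (n + 1) => Δs i.castSucc) ∧ Γ₂ = Δs (Fin.last (n + 1)) :=
      ⟨Fin.snoc (α := fun _ => Ctx S) Γs Γ₂, by simp, by simp⟩
    exact ⟨Δs, ⟨.snoc s' s⟩, Fin.lastCases h₂ hs⟩

lemma names_toLeaf (Γ : Ctx S) : (Γ.map toLeaf).map Prod.fst = Γ.names.map Name.free := by
  simp [Ctx.names, toLeaf, Function.comp_def]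

lemma nodup_names_iff {X : C} {T : CTree M X} {Γ : Ctx S} (h : (Γ.map toLeaf).Perm T.leaves) :
    T.names.Nodup ↔ IsCtx Γ := by
  rw [CTree.names, ← (h.map Prod.fst).nodup_iff, names_toLeaf,
    List.nodup_map_iff fun _ _ h => Name.free.inj h]
  rfl

lemma exists_free_of_mem {X : C} {T : CTree M X} {Γ : Ctx S} (h : (Γ.map toLeaf).Perm T.leaves)
    {n : Name} (hn : n ∈ T.names) : ∃ x ∈ Γ.names, n = .free x := by
  rw [CTree.names, ← (h.map Prod.fst).mem_iff, names_toLeaf] at hn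
  obtain ⟨x, hx, rfl⟩ := List.mem_map.1 hn
  exact ⟨x, hx, rfl⟩

lemma exists_split {X Y Z : C} {T : CTree M X} {U : CTree M Y} {W : CTree M Z} {c : X ⟶ Y ⊗ Z}
    (hc : Can T (U.tensor W) c) {Γ : Ctx S} (hΓ : IsCtx Γ) {ρ : Name → Name}
    (h : (Γ.map toLeaf).Perm (T.map ρ).leaves) :
    ∃ Γ₁ Γ₂, Nonempty (Shuffle Γ₁ Γ₂ Γ) ∧ IsCtx Γ₁ ∧ IsCtx Γ₂ ∧
      (Γ₁.map toLeaf).Perm (U.map ρ).leaves ∧ (Γ₂.map toLeaf).Perm (W.map ρ).leaves := by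
  have h' := h.trans (hc.map ρ).perm
  obtain ⟨Γ₁, Γ₂, s, h₁, h₂⟩ := exists_shuffle h'
  have := (nodup_names_iff h').2 hΓ
  rw [CTree.map, CTree.names_tensor] at this
  exact ⟨Γ₁, Γ₂, s, (nodup_names_iff h₁).1 this.of_append_left,
    (nodup_names_iff h₂).1 this.of_append_right, h₁, h₂⟩

lemma exists_fresh (Γ : Ctx S) : ∃ x, x ∉ Γ.names :=
  Infinite.exists_notMem_finset Γ.names.toFinset |>.imp fun x hx => by simpa using hx

/-- The converse of `Der.den`. Contexts under a binder have bound leaves and so are not typing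
contexts; the renaming `ρ` makes the induction possible by replacing indices with fresh variables.
The hypothesis `hp` forces the values of `ρ` on the names of `T` to be free variables of `Γ`. -/
lemma Den.typed_ren {X : C} {T : CTree M X} {t : Tm S} {A : Ty S.Ground} {f : X ⟶ M.ty A}
    (h : Den T t A f) (ρ : Name → Name) {Γ : Ctx S} (hΓ : IsCtx Γ)
    (hp : (Γ.map toLeaf).Perm (T.map ρ).leaves) : Typed Γ (t.ren ρ) A := by
  have key : ∀ {X : C} {T : CTree M X} {n : Name} {A : Ty S.Ground} {c : X ⟶ M.ty A}
      (ρ : Name → Name) {Γ : Ctx S}, Can T (.leaf n A) c → (Γ.map toLeaf).Perm (T.map ρ).leaves →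
      Typed Γ (Tm.ofName (ρ n)) A := by
    intro X T n A c ρ Γ h hp
    have := List.perm_singleton.1 (hp.trans (h.map ρ).perm)
    obtain ⟨⟨x, B⟩, rfl, hx⟩ := List.map_eq_singleton_iff.1 this
    simp only [toLeaf, Prod.mk.injEq] at hx
    rw [← hx.1, ← hx.2]
    exact ⟨.hyp x B⟩
  induction h generalizing ρ Γ with
  | bvar h => exact key ρ h hp
  | fvar h => exact key ρ h hp
  | op f h _ ih =>
    have hp' := hp.trans (h.map ρ).perm
    rw [CTree.map_tensorN] at hp'
    obtain ⟨Γs, ⟨s⟩, hs⟩ := exists_mshuffle _ _ hp'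
    have hn := CTree.nodup_of_tensorN _ _ ((nodup_names_iff hp').2 hΓ)
    have := fun i => ih i ρ ((nodup_names_iff (hs i)).1 (hn i)) (hs i)
    exact ⟨.ax f (fun i => (this i).some) hΓ s⟩
  | star h =>
    have := (hp.trans (h.map ρ).perm).eq_nil
    rw [List.map_eq_nil_iff] at this
    subst this
    exact ⟨.unitI⟩
  | toStar h _ _ iha ihb =>
    obtain ⟨Γ₁, Γ₂, ⟨s⟩, h₁, h₂, k₁, k₂⟩ := exists_split h hΓ hp
    exact ⟨.unitE (iha ρ h₁ k₁).some (ihb ρ h₂ k₂).some hΓ s⟩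
  | tensor h _ _ iha ihb =>
    obtain ⟨Γ₁, Γ₂, ⟨s⟩, h₁, h₂, k₁, k₂⟩ := exists_split h hΓ hp
    exact ⟨.tensorI (iha ρ h₁ k₁).some (ihb ρ h₂ k₂).some hΓ s⟩
  | @pm _ _ _ T U W c a b A B D f k h ha hb iha ihb =>
    obtain ⟨Γ₁, Γ₂, ⟨s⟩, h₁, h₂, k₁, k₂⟩ := exists_split h hΓ hp
    obtain ⟨x, hx⟩ := exists_fresh Γ₂
    obtain ⟨y, hy⟩ := exists_fresh ((x, A) :: Γ₂)
    simp only [Ctx.names, List.map_cons, List.mem_cons, not_or] at hx hy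
    have hb' := ihb (Name.cons y (Name.cons x ρ)) (Γ := (y, B) :: (x, A) :: Γ₂)
      (by simp only [IsCtx, Ctx.names, List.map_cons, List.nodup_cons, List.mem_cons, not_or]
          exact ⟨hy, hx, h₂⟩)
      (by rw [CTree.map_cons_under, CTree.map_cons_under]
          simp only [CTree.leaves, List.append_assoc]
          exact (List.Perm.swap _ _ _).trans ((List.perm_append_comm
            (l₁ := [toLeaf (x, A), toLeaf (y, B)])).trans (k₂.append_right _)))
    -- Opening with fresh variables and closing them again acts as the lifted renaming. Agreement is
    -- needed only on names that occur in `b`; apart from the two indices, `ρ` sends these to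
    -- variables of `Γ₂`, which differ from `x` and `y`.
    have e : Tm.pmTo (a.ren ρ) x y (b.ren (Name.cons y (Name.cons x ρ))) =
        Tm.pm (a.ren ρ) (b.ren (lift (lift ρ))) := by
      rw [Tm.pmTo, Tm.closeAt_eq_ren, Tm.closeAt_eq_ren, Tm.ren_ren, Tm.ren_ren]
      congr 1
      refine Tm.ren_congr _ fun n hn => ?_
      rw [← hb.mem_names_iff] at hn
      obtain rfl | ⟨m, rfl⟩ := eq_shift_or n
      · simp [Name.cons, close, lift, hy.1]
      rw [CTree.shift_mem_names_under] at hn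
      rw [cons_shift, lift_shift]
      obtain rfl | ⟨m, rfl⟩ := eq_shift_or m
      · simp [Name.cons, close, lift, shift]
      rw [CTree.shift_mem_names_under] at hn
      obtain ⟨z, hz, hmz⟩ := exists_free_of_mem k₂
        (by rw [CTree.names_map]; exact List.mem_map_of_mem hn)
      have h1 : z ≠ x := by rintro rfl; exact hx hz
      have h2 : z ≠ y := by rintro rfl; exact hy.2 hz
      rw [cons_shift, lift_shift, hmz]
      simp [close, h1, h2, shift]
    rw [Tm.ren, ← e]
    exact ⟨.tensorE x y (iha ρ h₁ k₁).some hb'.some hΓ s⟩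
  | @lam _ T b A B f h ih =>
    obtain ⟨x, hx⟩ := exists_fresh Γ
    have hb := ih (Name.cons x ρ) (Γ := (x, A) :: Γ) (List.nodup_cons.2 ⟨hx, hΓ⟩)
      (by rw [CTree.map_cons_under]
          exact (hp.cons _).trans (List.perm_append_singleton _ _).symm)
    -- As for pattern matching, opening followed by closing is the lifted renaming on the names that
    -- occur, by freshness of `x`.
    have e : Tm.abs x A (b.ren (Name.cons x ρ)) = Tm.lam A (b.ren (lift ρ)) := by
      rw [Tm.abs, Tm.closeAt_eq_ren, Tm.ren_ren]
      congr 1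
      refine Tm.ren_congr _ fun n hn => ?_
      rw [← h.mem_names_iff] at hn
      obtain rfl | ⟨m, rfl⟩ := eq_shift_or n
      · simp [Name.cons, close, lift]
      · rw [CTree.shift_mem_names_under] at hn
        obtain ⟨z, hz, hmz⟩ := exists_free_of_mem hp
          (by rw [CTree.names_map]; exact List.mem_map_of_mem hn)
        have : z ≠ x := by rintro rfl; exact hx hz
        rw [cons_shift, lift_shift, hmz]
        simp [close, this, shift]
    rw [Tm.ren, ← e]
    exact ⟨.lolliI x hb.some⟩
  | app h _ _ iha ihb =>
    obtain ⟨Γ₁, Γ₂, ⟨s⟩, h₁, h₂, k₁, k₂⟩ := exists_split h hΓ hp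
    exact ⟨.lolliE (iha ρ h₁ k₁).some (ihb ρ h₂ k₂).some hΓ s⟩

lemma Den.typed {X : C} {T : CTree M X} {t : Tm S} {A : Ty S.Ground} {f : X ⟶ M.ty A}
    (h : Den T t A f) {Γ : Ctx S} (hΓ : IsCtx Γ) (hp : (Γ.map toLeaf).Perm T.leaves) :
    Typed Γ t A := by
  have := h.typed_ren (fun n => n) hΓ (by rwa [CTree.map_id])
  rwa [Tm.ren_id] at this

/-- The interpretation of a derivation is determined by any denotation of the term. -/
lemma Der.sem_eq {Γ : Ctx S} {t : Tm S} {A : Ty S.Ground} (d : Der Γ t A) {X : C}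
    {T : CTree M X} {f : X ⟶ M.ty A} (h : Den T t A f) {c : M.ctx Γ ⟶ X}
    (hc : Can (ctxTree M Γ) T c) : d.sem M = c ≫ f :=
  eq_of_heq (Sigma.mk.inj_iff.1 ((d.den M).unique (nodup_ctxTree d.isCtx) hc h)).2

/-! ## The classical equations -/

section Equations

variable {X Y Z : C} {A B D : Ty S.Ground}

lemma pmTy_tensorTy (f : X ⟶ M.ty A) (h : Y ⟶ M.ty B) (k : (Z ⊗ M.ty A) ⊗ M.ty B ⟶ M.ty D) :
    pmTy (tensorTy f h) k =
      ((β_ (X ⊗ Y) Z).hom ≫ (α_ Z X Y).inv) ≫ ((Z ◁ f) ⊗ₘ h) ≫ k := by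
  have : (f ⊗ₘ h) ▷ Z ≫ (β_ (M.ty A ⊗ M.ty B) Z).hom ≫ (α_ Z (M.ty A) (M.ty B)).inv ≫ k =
      ((β_ (X ⊗ Y) Z).hom ≫ (α_ Z X Y).inv) ≫ ((Z ◁ f) ⊗ₘ h) ≫ k := by
    rw [BraidedCategory.braiding_naturality_left_assoc, ← id_tensorHom, ← id_tensorHom,
      associator_inv_naturality_assoc]
    simp
  exact this

lemma pmTy_tensorTy_id (f : X ⟶ M.ty (Ty.tensor A B)) (k : Y ⊗ M.ty (Ty.tensor A B) ⟶ M.ty D) :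
    pmTy f ((α_ Y (M.ty A) (M.ty B)).hom ≫ Y ◁ tensorTy (𝟙 (M.ty A)) (𝟙 (M.ty B)) ≫ k) =
      (β_ X Y).hom ≫ Y ◁ f ≫ k := by
  have : ∀ (f : X ⟶ M.ty A ⊗ M.ty B) (k : Y ⊗ (M.ty A ⊗ M.ty B) ⟶ M.ty D),
      f ▷ Y ≫ (β_ (M.ty A ⊗ M.ty B) Y).hom ≫ (α_ Y (M.ty A) (M.ty B)).inv ≫
        (α_ Y (M.ty A) (M.ty B)).hom ≫ Y ◁ (𝟙 (M.ty A) ⊗ₘ 𝟙 (M.ty B)) ≫ k =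
      (β_ X Y).hom ≫ Y ◁ f ≫ k := by
    intro f k
    rw [Iso.inv_hom_id_assoc, id_tensorHom_id, MonoidalCategory.whiskerLeft_id, Category.id_comp,
      BraidedCategory.braiding_naturality_left_assoc]
  exact this f k

lemma toStarTy_starTy (f : X ⟶ Y) : toStarTy (starTy M) f = (λ_ X).hom ≫ f := by
  have : 𝟙 (𝟙_ C) ▷ X ≫ (λ_ X).hom ≫ f = (λ_ X).hom ≫ f := by simp
  exact this

lemma toStarTy_comp_starTy (f : X ⟶ M.ty Ty.unit) (k : Y ⊗ M.ty Ty.unit ⟶ M.ty D) :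
    toStarTy f ((ρ_ Y).inv ≫ Y ◁ starTy M ≫ k) = (β_ X Y).hom ≫ Y ◁ f ≫ k := by
  have : ∀ (f : X ⟶ 𝟙_ C) (k : Y ⊗ 𝟙_ C ⟶ M.ty D),
      f ▷ Y ≫ (λ_ Y).hom ≫ (ρ_ Y).inv ≫ Y ◁ 𝟙 (𝟙_ C) ≫ k = (β_ X Y).hom ≫ Y ◁ f ≫ k := by
    intro f k
    rw [← BraidedCategory.braiding_naturality_left_assoc]
    simp
  exact this f k

/-- Tensoring `f` curried with `h` applies `h` first and then the curried map; followed by the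
counit, the latter is `f` again. -/
lemma appTy_curryTy (f : X ⊗ M.ty A ⟶ M.ty B) (h : Y ⟶ M.ty A) :
    appTy (curryTy f) h = X ◁ h ≫ f := by
  have h1 : curryTy f ▷ M.ty A ≫ (lolliAdjunction (M.ty A)).counit.app (M.ty B) = f :=
    ((lolliAdjunction (M.ty A)).homEquiv_counit _ _ _).symm.trans
      (((lolliAdjunction (M.ty A)).homEquiv X (M.ty B)).symm_apply_apply f)
  have : ∀ c : X ⟶ (ihom (M.ty A)).obj (M.ty B),
      (c ⊗ₘ h) ≫ (lolliAdjunction (M.ty A)).counit.app (M.ty B) =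
      X ◁ h ≫ c ▷ M.ty A ≫ (lolliAdjunction (M.ty A)).counit.app (M.ty B) := by
    intro c
    rw [MonoidalCategory.tensorHom_def', Category.assoc]
  exact (this (curryTy f)).trans (congrArg (X ◁ h ≫ ·) h1)

lemma curryTy_appTy (f : X ⟶ M.ty (Ty.lolli A B)) :
    curryTy (appTy f (𝟙 (M.ty A))) = f := by
  refine ((lolliAdjunction (M.ty A)).homEquiv X (M.ty B)).symm.injective ?_
  refine (((lolliAdjunction (M.ty A)).homEquiv X (M.ty B)).symm_apply_apply _).trans ?_
  refine Eq.trans ?_ ((lolliAdjunction (M.ty A)).homEquiv_counit _ _ _).symm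
  have : ∀ c : X ⟶ (ihom (M.ty A)).obj (M.ty B),
      (c ⊗ₘ 𝟙 (M.ty A)) ≫ (lolliAdjunction (M.ty A)).counit.app (M.ty B) =
      c ▷ M.ty A ≫ (lolliAdjunction (M.ty A)).counit.app (M.ty B) := by
    intro c
    rw [tensorHom_id]
  exact this f

lemma whiskerLeft_toStarTy (f : X ⟶ M.ty Ty.unit) (h : Y ⟶ M.ty A) (k : Z ⊗ M.ty A ⟶ M.ty B) :
    Z ◁ toStarTy f h ≫ k =
      ((α_ Z X Y).inv ≫ (β_ Z X).hom ▷ Y ≫ (α_ X Z Y).hom) ≫ toStarTy f (Z ◁ h ≫ k) := by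
  have : ∀ f : X ⟶ 𝟙_ C, Z ◁ (f ▷ Y ≫ (λ_ Y).hom ≫ h) ≫ k =
      ((α_ Z X Y).inv ≫ (β_ Z X).hom ▷ Y ≫ (α_ X Z Y).hom) ≫
        f ▷ (Z ⊗ Y) ≫ (λ_ (Z ⊗ Y)).hom ≫ Z ◁ h ≫ k := by
    intro f
    simp only [Category.assoc, ← associator_naturality_left_assoc, ← comp_whiskerRight_assoc,
      ← BraidedCategory.braiding_naturality_right]
    simp
  exact this f

lemma whiskerLeft_pmTy (f : X ⟶ M.ty (Ty.tensor A B)) (h : (Y ⊗ M.ty A) ⊗ M.ty B ⟶ M.ty D)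
    {E : Ty S.Ground} (k : Z ⊗ M.ty D ⟶ M.ty E) :
    Z ◁ pmTy f h ≫ k =
      ((α_ Z X Y).inv ≫ (β_ Z X).hom ▷ Y ≫ (α_ X Z Y).hom) ≫
        pmTy f ((α_ Z Y (M.ty A)).hom ▷ M.ty B ≫ (α_ Z (Y ⊗ M.ty A) (M.ty B)).hom ≫
          Z ◁ h ≫ k) := by
  -- By the hexagon the final braiding moves `P` back across `Z` and then across `Y`; the crossing
  -- with `Z` cancels against the first braiding by symmetry.
  have key : ∀ P : C, (α_ Z P Y).inv ≫ (β_ Z P).hom ▷ Y ≫ (α_ P Z Y).hom ≫ (β_ P (Z ⊗ Y)).hom =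
      Z ◁ (β_ P Y).hom ≫ (α_ Z Y P).inv := by
    intro P
    simp [← comp_whiskerRight_assoc]
  have : ∀ {P Q R : C} (f : X ⟶ P ⊗ Q) (h : (Y ⊗ P) ⊗ Q ⟶ R) (k : Z ⊗ R ⟶ M.ty E),
      Z ◁ (f ▷ Y ≫ (β_ (P ⊗ Q) Y).hom ≫ (α_ Y P Q).inv ≫ h) ≫ k =
      ((α_ Z X Y).inv ≫ (β_ Z X).hom ▷ Y ≫ (α_ X Z Y).hom) ≫
        f ▷ (Z ⊗ Y) ≫ (β_ (P ⊗ Q) (Z ⊗ Y)).hom ≫ (α_ (Z ⊗ Y) P Q).inv ≫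
        (α_ Z Y P).hom ▷ Q ≫ (α_ Z (Y ⊗ P) Q).hom ≫ Z ◁ h ≫ k := by
    intro P Q R f h k
    simp only [Category.assoc, ← associator_naturality_left_assoc, ← comp_whiskerRight_assoc,
      ← BraidedCategory.braiding_naturality_right]
    rw [comp_whiskerRight, Category.assoc, ← associator_inv_naturality_middle_assoc,
      reassoc_of% key (P ⊗ Q)]
    simp
  exact this f h k

end Equations
end LinLam

namespace LinLam
open Name

variable {S : Signature.{g, w}} {C : Type u} [Category.{v} C] [MonoidalCategory C]
  [SymmetricCategory C] [MonoidalClosed C]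

lemma Typed.isCtx {Γ : Ctx S} {v : Tm S} {A : Ty S.Ground} (h : Typed Γ v A) : IsCtx Γ :=
  h.some.isCtx

lemma Typed.exists_den (M : Interp S C) {Γ : Ctx S} {v : Tm S} {A : Ty S.Ground}
    (h : Typed Γ v A) : ∃ f, Den (ctxTree M Γ) v A f :=
  ⟨_, h.some.den M⟩

lemma Typed.exists_den_snoc (M : Interp S C) {Γ : Ctx S} {x : Var} {v : Tm S}
    {A B : Ty S.Ground} (h : Typed ((x, A) :: Γ) v B) :
    .free x ∉ (ctxTree M Γ).names ∧
      ∃ f, Den ((ctxTree M Γ).tensor (.leaf (.free x) A)) v B f :=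
  ⟨by rw [free_mem_names_ctxTree]; exact (List.nodup_cons.1 h.isCtx).1,
    _, (h.some.den M).can (M.can_snoc Γ x A)⟩

lemma Typed.exists_den_snoc_snoc (M : Interp S C) {Γ : Ctx S} {x y : Var} {v : Tm S}
    {A B D : Ty S.Ground} (h : Typed ((y, B) :: (x, A) :: Γ) v D) :
    .free x ∉ (ctxTree M Γ).names ∧ .free y ∉ (ctxTree M Γ).names ∧ x ≠ y ∧
      ∃ f, Den (((ctxTree M Γ).tensor (.leaf (.free x) A)).tensor (.leaf (.free y) B)) v D f := by
  have hc := h.isCtx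
  simp only [IsCtx, Ctx.names, List.map_cons, List.nodup_cons, List.mem_cons, not_or] at hc
  refine ⟨?_, ?_, Ne.symm hc.1.1, _,
    ((h.some.den M).can (M.can_snoc _ y B)).can ((M.can_snoc Γ x A).whiskerRight _)⟩
  · rw [free_mem_names_ctxTree]; exact hc.2.1
  · rw [free_mem_names_ctxTree]; exact hc.1.2

lemma toLeaf_perm₂ {M : Interp S C} {E Γ Δ : Ctx S} (h : E.Perm (Δ ++ Γ)) :
    (E.map toLeaf).Perm ((ctxTree M Γ).tensor (ctxTree M Δ)).leaves := by
  refine ((h.trans List.perm_append_comm).map toLeaf).trans ?_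
  rw [List.map_append]
  exact ((leaves_ctxTree_perm Γ).append (leaves_ctxTree_perm Δ)).symm

lemma toLeaf_perm₃ {M : Interp S C} {E Γ Δ Θ : Ctx S} (h : E.Perm (Θ ++ Δ ++ Γ)) :
    (E.map toLeaf).Perm
      ((ctxTree M Γ).tensor ((ctxTree M Δ).tensor (ctxTree M Θ))).leaves := by
  refine ((h.trans (List.perm_append_comm.trans
    (List.perm_append_comm.append_left Γ))).map toLeaf).trans ?_
  rw [List.map_append, List.map_append]
  exact ((leaves_ctxTree_perm Γ).append
    ((leaves_ctxTree_perm Δ).append (leaves_ctxTree_perm Θ))).symm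

/-- Both sides of a classical equation have the same denotation. -/
theorem ClassicalEq.exists_den (M : Interp S C) {E : Ctx S} {v w : Tm S} {A : Ty S.Ground}
    (h : ClassicalEq E v w A) :
    IsCtx E ∧ ∃ (X : C) (T : CTree M X) (f : X ⟶ M.ty A),
      (E.map toLeaf).Perm T.leaves ∧ Den T v A f ∧ Den T w A f := by
  -- In each case `T` is the bracketing in which the left side denotes most directly. The right side
  -- is brought there by a structural morphism if necessary, and the matching semantic identity
  -- equates the two morphisms. The given order `E` enters only as a permutation of the leaves.
  cases h with
  | tensor_beta hv hw hu hE hp =>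
    obtain ⟨f, hf⟩ := hv.exists_den M
    obtain ⟨k, hk⟩ := hw.exists_den M
    obtain ⟨hx, hy, hxy, l, hl⟩ := hu.exists_den_snoc_snoc M
    refine ⟨hE, _, _, _, ?_, (hf.tensor' hk).pmTo hl (closed_ctxTree _) hx hy hxy, ?_⟩
    · exact (toLeaf_perm₃ hp).trans (Can.assoc_inv _ _ _).perm
    · rw [pmTy_tensorTy]
      exact (hl.subst₂ hx hy hxy hf (closed_ctxTree _) hk (closed_ctxTree _)).can
        ((Can.braid _ _).trans (Can.assoc_inv _ _ _))
  | tensor_eta hv hu hxy hx hy hE hp =>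
    obtain ⟨f, hf⟩ := hv.exists_den M
    obtain ⟨hz, l, hl⟩ := hu.exists_den_snoc M
    rw [← free_mem_names_ctxTree (M := M)] at hx hy
    refine ⟨hE, _, _, _, toLeaf_perm₂ hp, hf.pmTo ((hl.subst₁ hz
      ((Den.fvar' _ _).tensor' (Den.fvar' _ _))
      ((CTree.closed_leaf _ _).tensor (CTree.closed_leaf _ _))).can (Can.assoc _ _ _))
      (closed_ctxTree _) hx hy hxy, ?_⟩
    rw [pmTy_tensorTy_id]
    exact (hl.subst₁ hz hf (closed_ctxTree _)).can (Can.braid _ _)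
  | unit_beta hv =>
    obtain ⟨f, hf⟩ := hv.exists_den M
    refine ⟨hv.isCtx, _, _, _, ?_, Den.star'.toStar' hf, ?_⟩
    · exact (leaves_ctxTree_perm _).symm.trans (Can.lunit_inv _).perm
    · rw [toStarTy_starTy]
      exact hf.can (Can.lunit _)
  | unit_eta hv hw hE hp =>
    obtain ⟨f, hf⟩ := hv.exists_den M
    obtain ⟨hz, l, hl⟩ := hw.exists_den_snoc M
    refine ⟨hE, _, _, _, toLeaf_perm₂ hp, hf.toStar' ((hl.subst₁ hz Den.star'
      CTree.closed_unit).can (Can.runit_inv _)), ?_⟩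
    rw [toStarTy_comp_starTy]
    exact (hl.subst₁ hz hf (closed_ctxTree _)).can (Can.braid _ _)
  | lolli_beta hv hw hE hp =>
    obtain ⟨hx, l, hl⟩ := hv.exists_den_snoc M
    obtain ⟨k, hk⟩ := hw.exists_den M
    refine ⟨hE, _, _, _, toLeaf_perm₂ hp, (hl.abs (closed_ctxTree _) hx).app' hk, ?_⟩
    rw [appTy_curryTy]
    exact hl.subst₁ hx hk (closed_ctxTree _)
  | lolli_eta hv hx =>
    obtain ⟨f, hf⟩ := hv.exists_den M
    rw [← free_mem_names_ctxTree (M := M)] at hx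
    refine ⟨hv.isCtx, _, _, _, (leaves_ctxTree_perm _).symm,
      (hf.app' (Den.fvar' _ _)).abs (closed_ctxTree _) hx, ?_⟩
    rwa [curryTy_appTy]
  | unit_comm hu hv hw hE hp =>
    obtain ⟨hz, l, hl⟩ := hu.exists_den_snoc M
    obtain ⟨f, hf⟩ := hv.exists_den M
    obtain ⟨k, hk⟩ := hw.exists_den M
    refine ⟨hE, _, _, _, toLeaf_perm₃ hp, hl.subst₁ hz (hf.toStar' hk)
      ((closed_ctxTree _).tensor (closed_ctxTree _)), ?_⟩
    rw [whiskerLeft_toStarTy]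
    exact (hf.toStar' (hl.subst₁ hz hk (closed_ctxTree _))).can
      ((Can.assoc_inv _ _ _).trans (((Can.braid _ _).whiskerRight _).trans (Can.assoc _ _ _)))
  | tensor_comm hu hv hw hx hy hE hp =>
    obtain ⟨hz, l, hl⟩ := hu.exists_den_snoc M
    obtain ⟨f, hf⟩ := hv.exists_den M
    obtain ⟨hx', hy', hxy, k, hk⟩ := hw.exists_den_snoc_snoc M
    rw [← free_mem_names_ctxTree (M := M)] at hx hy
    refine ⟨hE, _, _, _, toLeaf_perm₃ hp, hl.subst₁ hz (hf.pmTo hk (closed_ctxTree _) hx' hy' hxy)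
      ((closed_ctxTree _).tensor (closed_ctxTree _)), ?_⟩
    rw [whiskerLeft_pmTy]
    -- Substituting `w` into `u` leaves `x` and `y` nested inside the right factor; reassociation
    -- makes them the last two leaves, as pattern matching needs.
    have := (hl.subst₁ hz hk (((closed_ctxTree _).tensor (CTree.closed_leaf _ _)).tensor
      (CTree.closed_leaf _ _))).can (((Can.assoc _ _ _).whiskerRight _).trans (Can.assoc _ _ _))
    rw [Category.assoc] at this
    exact (hf.pmTo this ((closed_ctxTree _).tensor (closed_ctxTree _))
      (by simp [hx, hx']) (by simp [hy, hy']) hxy).can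
      ((Can.assoc_inv _ _ _).trans (((Can.braid _ _).whiskerRight _).trans (Can.assoc _ _ _)))

/-! ## Distances in an enriched autonomous category -/

section Enriched

variable {V : Type t} [CommMonoid V] [CompleteLattice V] [IsQuantale V] [VCatEnriched V C]

/-- The distance of two parallel morphisms. -/
def homDist (V : Type t) [CommMonoid V] [CompleteLattice V] [IsQuantale V] [VCatEnriched V C]
    {X Y : C} (f f' : X ⟶ Y) : V :=
  (VCatEnriched.hom (V := V) X Y).dist f f'

omit [MonoidalCategory C] [SymmetricCategory C] [MonoidalClosed C] in
lemma one_le_homDist {X Y : C} (f : X ⟶ Y) : (1 : V) ≤ homDist V f f :=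
  (VCatEnriched.hom X Y).one_le_dist f

omit [MonoidalCategory C] [SymmetricCategory C] [MonoidalClosed C] in
lemma homDist_trans {X Y : C} (f f' f'' : X ⟶ Y) :
    homDist V f f' * homDist V f' f'' ≤ homDist V f f'' :=
  (VCatEnriched.hom X Y).dist_mul_dist f f' f''

omit [MonoidalCategory C] [SymmetricCategory C] [MonoidalClosed C] in
lemma homDist_comp {X Y Z : C} (f f' : X ⟶ Y) (k k' : Y ⟶ Z) :
    homDist V f f' * homDist V k k' ≤ homDist V (f ≫ k) (f' ≫ k') :=
  VCatEnriched.comp_isVFunctor X Y Z (f, k) (f', k')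

omit [MonoidalCategory C] [SymmetricCategory C] [MonoidalClosed C] in
-- A fixed morphism has self-distance at least the unit, so composing with it cannot lower a
-- distance.
lemma homDist_comp_left {X Y Z : C} (f : X ⟶ Y) (k k' : Y ⟶ Z) :
    homDist V k k' ≤ homDist V (f ≫ k) (f ≫ k') := by
  refine le_trans ?_ (homDist_comp f f k k')
  exact (one_mul (homDist V k k')).symm.le.trans (mul_le_mul' (one_le_homDist f) le_rfl)

omit [MonoidalCategory C] [SymmetricCategory C] [MonoidalClosed C] in
lemma homDist_comp_right {X Y Z : C} (f f' : X ⟶ Y) (k : Y ⟶ Z) :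
    homDist V f f' ≤ homDist V (f ≫ k) (f' ≫ k) := by
  refine le_trans ?_ (homDist_comp f f' k k)
  exact (mul_one (homDist V f f')).symm.le.trans (mul_le_mul' le_rfl (one_le_homDist k))

variable [VCatAutonomous V C]

lemma homDist_tensorHom {X Y X' Y' : C} (f f' : X ⟶ Y) (k k' : X' ⟶ Y') :
    homDist V f f' * homDist V k k' ≤ homDist V (f ⊗ₘ k) (f' ⊗ₘ k') :=
  VCatAutonomous.tensor_isVCatFunctor (V := V) (C := C) (X, X') (Y, Y') (f, k) (f', k')

lemma homDist_whiskerRight {X Y : C} (f f' : X ⟶ Y) (Z : C) :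
    homDist V f f' ≤ homDist V (f ▷ Z) (f' ▷ Z) := by
  rw [← tensorHom_id, ← tensorHom_id]
  refine le_trans ?_ (homDist_tensorHom f f' (𝟙 Z) (𝟙 Z))
  exact (mul_one (homDist V f f')).symm.le.trans (mul_le_mul' le_rfl (one_le_homDist _))

lemma homDist_whiskerLeft {X Y : C} (f f' : X ⟶ Y) (Z : C) :
    homDist V f f' ≤ homDist V (Z ◁ f) (Z ◁ f') := by
  rw [← id_tensorHom, ← id_tensorHom]
  refine le_trans ?_ (homDist_tensorHom (𝟙 Z) (𝟙 Z) f f')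
  exact (one_mul (homDist V f f')).symm.le.trans (mul_le_mul' (one_le_homDist _) le_rfl)

variable {M : Interp S C} {X Y Z : C} {A B : Ty S.Ground}

/-- The semantic operations are built from composition, tensor and currying, all `V`-functors, and
from fixed morphisms, which cost nothing. This gives the bounds for the congruence rules. -/
lemma homDist_tensorTy (f f' : X ⟶ M.ty A) (k k' : Y ⟶ M.ty B) :
    homDist V f f' * homDist V k k' ≤ homDist V (tensorTy f k) (tensorTy f' k') :=
  homDist_tensorHom f f' k k'

lemma homDist_toStarTy (f f' : X ⟶ M.ty Ty.unit) (k k' : Y ⟶ Z) :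
    homDist V f f' * homDist V k k' ≤ homDist V (toStarTy f k) (toStarTy f' k') :=
  (mul_le_mul' (homDist_whiskerRight f f' Y) (homDist_comp_left (λ_ Y).hom k k')).trans
    (homDist_comp _ _ _ _)

lemma homDist_pmTy (f f' : X ⟶ M.ty (Ty.tensor A B)) (k k' : (Y ⊗ M.ty A) ⊗ M.ty B ⟶ Z) :
    homDist V f f' * homDist V k k' ≤ homDist V (pmTy f k) (pmTy f' k') :=
  (mul_le_mul' (homDist_whiskerRight f f' Y)
    ((homDist_comp_left (α_ Y (M.ty A) (M.ty B)).inv k k').trans (homDist_comp_left _ _ _))).trans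
    (homDist_comp _ _ _ _)

lemma homDist_curryTy (f f' : X ⊗ M.ty A ⟶ M.ty B) :
    homDist V f f' ≤ homDist V (curryTy f) (curryTy f') :=
  (VCatAutonomous.adjunction_isVCatAdjunction (V := V) (M.ty A) X (M.ty B)).1 f f'

lemma homDist_appTy (f f' : X ⟶ M.ty (Ty.lolli A B)) (k k' : Y ⟶ M.ty A) :
    homDist V f f' * homDist V k k' ≤ homDist V (appTy f k) (appTy f' k') :=
  (homDist_tensorHom f f' k k').trans (homDist_comp_right _ _ _)

lemma prod_le_homDist_tensorHomN (n : ℕ) {X Y : Fin (n + 1) → C} (f f' : ∀ i, X i ⟶ Y i)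
    (q : Fin (n + 1) → V) (h : ∀ i, q i ≤ homDist V (f i) (f' i)) :
    ∏ i, q i ≤ homDist V (tensorHomN n f) (tensorHomN n f') := by
  induction n with
  | zero => exact (le_of_eq (by simp)).trans (h 0)
  | succ n ih =>
    rw [Fin.prod_univ_castSucc]
    exact (mul_le_mul' (ih _ _ _ fun i => h i.castSucc) (h (Fin.last (n + 1)))).trans
      (homDist_tensorHom _ _ _ _)

lemma prod_le_homDist_opTy (f : S.Op) {X : Fin (S.ar f + 1) → C}
    (k k' : ∀ i, X i ⟶ M.ty (S.dom f i)) (q : Fin (S.ar f + 1) → V)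
    (h : ∀ i, q i ≤ homDist V (k i) (k' i)) :
    ∏ i, q i ≤ homDist V (opTy M f k) (opTy M f k') :=
  (prod_le_homDist_tensorHomN _ k k' q h).trans (homDist_comp_right _ _ _)

end Enriched

/-! ## Soundness -/

section Soundness

variable {V : Type t} [CommMonoid V] [CompleteLattice V] [IsQuantale V] [VCatEnriched V C]

/-- A satisfied `V`-equation between derivable judgements. -/
def Interp.Sound (M : Interp S C) (Γ : Ctx S) (v : Tm S) (q : V) (w : Tm S) (A : Ty S.Ground) :
    Prop :=
  Typed Γ v A ∧ Typed Γ w A ∧ M.Satisfies Γ v q w A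

/-- All derivations of the two judgements are interpreted by the same structural morphism followed
by `f` and `f'` respectively, so a bound found in any convenient bracketing of `E` is valid for the
interpretation itself. -/
lemma Interp.sound_of_den {M : Interp S C} {E : Ctx S} (hE : IsCtx E) {X : C} {T : CTree M X}
    (hT : (E.map toLeaf).Perm T.leaves) {v w : Tm S} {A : Ty S.Ground} {f f' : X ⟶ M.ty A}
    (hv : Den T v A f) (hw : Den T w A f') {q : V} (hq : q ≤ homDist V f f') :
    M.Sound E v q w A := by
  refine ⟨hv.typed hE hT, hw.typed hE hT, fun d e => ?_⟩
  obtain ⟨c, hc⟩ := Can.exists_of_perm ((leaves_ctxTree_perm (M := M) E).trans hT)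
  rw [d.sem_eq hv hc, e.sem_eq hw hc]
  exact hq.trans (homDist_comp_left c f f')

lemma Interp.Sound.exists_den {M : Interp S C} {Γ : Ctx S} {v w : Tm S} {A : Ty S.Ground} {q : V}
    (h : M.Sound Γ v q w A) : ∃ f f', Den (ctxTree M Γ) v A f ∧ Den (ctxTree M Γ) w A f' ∧
      q ≤ homDist V f f' := by
  obtain ⟨⟨d⟩, ⟨e⟩, h⟩ := h
  exact ⟨_, _, d.den M, e.den M, h d e⟩

lemma Interp.Sound.exists_den_snoc {M : Interp S C} {Γ : Ctx S} {x : Var} {v w : Tm S}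
    {A B : Ty S.Ground} {q : V} (h : M.Sound ((x, A) :: Γ) v q w B) :
    .free x ∉ (ctxTree M Γ).names ∧ ∃ f f',
      Den ((ctxTree M Γ).tensor (.leaf (.free x) A)) v B f ∧
      Den ((ctxTree M Γ).tensor (.leaf (.free x) A)) w B f' ∧ q ≤ homDist V f f' := by
  obtain ⟨f, f', hf, hf', hq⟩ := h.exists_den
  exact ⟨(h.1.exists_den_snoc M).1, _, _, hf.can (M.can_snoc Γ x A), hf'.can (M.can_snoc Γ x A),
    hq.trans (homDist_comp_left _ _ _)⟩

lemma Interp.Sound.exists_den_snoc_snoc {M : Interp S C} {Γ : Ctx S} {x y : Var} {v w : Tm S}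
    {A B D : Ty S.Ground} {q : V} (h : M.Sound ((y, B) :: (x, A) :: Γ) v q w D) :
    .free x ∉ (ctxTree M Γ).names ∧ .free y ∉ (ctxTree M Γ).names ∧ x ≠ y ∧ ∃ f f',
      Den (((ctxTree M Γ).tensor (.leaf (.free x) A)).tensor (.leaf (.free y) B)) v D f ∧
      Den (((ctxTree M Γ).tensor (.leaf (.free x) A)).tensor (.leaf (.free y) B)) w D f' ∧
      q ≤ homDist V f f' := by
  obtain ⟨-, f, f', hf, hf', hq⟩ := h.exists_den_snoc
  obtain ⟨hx, hy, hxy, -⟩ := h.1.exists_den_snoc_snoc M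
  exact ⟨hx, hy, hxy, _, _, hf.can ((M.can_snoc Γ x A).whiskerRight _),
    hf'.can ((M.can_snoc Γ x A).whiskerRight _), hq.trans (homDist_comp_left _ _ _)⟩

/-- Soundness of the deductive system. -/
theorem Thm.sound [VCatAutonomous V C] (integral : (1 : V) = ⊤) {B : Set V}
    (hB : IsLatticeBasis B) {M : Interp S C} {Ax : Set (VEquation S B)}
    (hAx : ∀ e ∈ Ax, M.Satisfies e.ctx e.lhs e.label e.rhs e.ty)
    {Γ : Ctx S} {v w : Tm S} {q : V} {A : Ty S.Ground} (h : Thm B Ax Γ v q w A) :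
    M.Sound Γ v q w A := by
  -- Integrality enters here: the label `⊤` of the equations is the unit, which bounds
  -- self-distances from below.
  have top_le : ∀ {X Y : C} (f : X ⟶ Y), (⊤ : V) ≤ homDist V f f :=
    fun f => integral ▸ one_le_homDist f
  induction h with
  | axm e he => exact ⟨e.lhs_typed, e.rhs_typed, hAx e he⟩
  | classical h =>
    obtain ⟨hE, X, T, f, hT, hv, hw⟩ := h.exists_den M
    exact Interp.sound_of_den hE hT hv hw (top_le f)
  | classical_symm h =>
    obtain ⟨hE, X, T, f, hT, hv, hw⟩ := h.exists_den M
    exact Interp.sound_of_den hE hT hw hv (top_le f)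
  | refl h =>
    obtain ⟨f, hf⟩ := h.exists_den M
    exact Interp.sound_of_den h.isCtx (leaves_ctxTree_perm _).symm hf hf (top_le f)
  | trans _ _ ih ih' =>
    refine ⟨ih.1, ih'.2.1, fun d e => ?_⟩
    -- The two hypotheses can only be combined through a derivation of the middle term; this is one
    -- reason to carry typability in the induction.
    obtain ⟨k⟩ := ih.2.1
    exact (mul_le_mul' (ih.2.2 d k) (ih'.2.2 k e)).trans (homDist_trans _ _ _)
  | weak _ _ hr ih => exact ⟨ih.1, ih.2.1, fun d e => hr.trans (ih.2.2 d e)⟩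
  | @arch _ _ _ _ q _ _ ih =>
    -- Some basis element lies way below `q`, and its instance of the premise supplies typability;
    -- the bound holds because `q` is the least upper bound of all such elements.
    obtain ⟨⟨r, hr, hrq⟩, -, hlub⟩ := hB q
    have h := ih r hr hrq
    exact ⟨h.1, h.2.1, fun d e => hlub.2 fun r hr => (ih r hr.1 hr.2).2.2 d e⟩
  -- For `n = 0` there is no premise, so typability comes from the typing hypotheses of the rule.
  | join hv hw _ ih => exact ⟨hv, hw, fun d e => iSup_le fun i => (ih i).2.2 d e⟩
  | tensorI _ _ hE s ih ih' =>
    obtain ⟨f, f', hf, hf', hq⟩ := ih.exists_den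
    obtain ⟨k, k', hk, hk', hr⟩ := ih'.exists_den
    exact Interp.sound_of_den hE (toLeaf_perm₂ s.perm) (hf.tensor' hk) (hf'.tensor' hk')
      ((mul_le_mul' hq hr).trans (homDist_tensorTy _ _ _ _))
  | op f _ hE s ih =>
    choose k k' hk hk' hq using fun i => (ih i).exists_den
    exact Interp.sound_of_den hE ((leaves_ctxTree_perm _).symm.trans (M.can_shN s).perm)
      (.op f (M.can_spN _ _) hk) (.op f (M.can_spN _ _) hk')
      ((prod_le_homDist_opTy f k k' _ hq).trans (homDist_comp_left _ _ _))
  | unitE _ _ hE s ih ih' =>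
    obtain ⟨f, f', hf, hf', hq⟩ := ih.exists_den
    obtain ⟨k, k', hk, hk', hr⟩ := ih'.exists_den
    exact Interp.sound_of_den hE (toLeaf_perm₂ s.perm) (hf.toStar' hk) (hf'.toStar' hk')
      ((mul_le_mul' hq hr).trans (homDist_toStarTy _ _ _ _))
  | lolliI _ ih =>
    obtain ⟨hx, f, f', hf, hf', hq⟩ := ih.exists_den_snoc
    exact Interp.sound_of_den (List.nodup_cons.1 ih.1.isCtx).2 (leaves_ctxTree_perm _).symm
      (hf.abs (closed_ctxTree _) hx) (hf'.abs (closed_ctxTree _) hx)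
      (hq.trans (homDist_curryTy _ _))
  | tensorE _ _ hE s ih ih' =>
    obtain ⟨f, f', hf, hf', hq⟩ := ih.exists_den
    obtain ⟨hx, hy, hxy, k, k', hk, hk', hr⟩ := ih'.exists_den_snoc_snoc
    exact Interp.sound_of_den hE (toLeaf_perm₂ s.perm)
      (hf.pmTo hk (closed_ctxTree _) hx hy hxy) (hf'.pmTo hk' (closed_ctxTree _) hx hy hxy)
      ((mul_le_mul' hq hr).trans (homDist_pmTy _ _ _ _))
  | lolliE _ _ hE s ih ih' =>
    obtain ⟨f, f', hf, hf', hq⟩ := ih.exists_den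
    obtain ⟨k, k', hk, hk', hr⟩ := ih'.exists_den
    exact Interp.sound_of_den hE (toLeaf_perm₂ s.perm) (hf.app' hk) (hf'.app' hk')
      ((mul_le_mul' hq hr).trans (homDist_appTy _ _ _ _))
  | perm _ hp ih =>
    obtain ⟨f, f', hf, hf', hq⟩ := ih.exists_den
    exact Interp.sound_of_den ((hp.map Prod.fst).nodup_iff.2 ih.1.isCtx)
      ((hp.map toLeaf).trans (leaves_ctxTree_perm _).symm) hf hf' hq
  | subst _ _ hE ih ih' =>
    obtain ⟨hx, f, f', hf, hf', hq⟩ := ih.exists_den_snoc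
    obtain ⟨k, k', hk, hk', hr⟩ := ih'.exists_den
    refine Interp.sound_of_den hE (toLeaf_perm₂ (.refl _)) (hf.subst₁ hx hk (closed_ctxTree _))
      (hf'.subst₁ hx hk' (closed_ctxTree _)) ?_
    -- In the denotation of a substitution the substituted term is composed first, so its bound `r`
    -- must come first.
    rw [mul_comm]
    exact (mul_le_mul' (hr.trans (homDist_whiskerLeft _ _ _)) hq).trans (homDist_comp _ _ _ _)

end Soundness

end LinLam

theorem mainTheorem5
    {V : Type t} [CommMonoid V] [CompleteLattice V] [IsQuantale V]
    (integral : (1 : V) = ⊤) (continuous : IsContinuousLattice V)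
    (B : Set V) (hB : IsLabelBasis B)
    {C : Type u} [Category.{v} C] [MonoidalCategory C] [SymmetricCategory C] [MonoidalClosed C]
    [VCatEnriched V C] [VCatAutonomous V C]
    (S : Signature.{g, w}) (M : Interp S C) :
    (∀ (Γ : Ctx S) (v : Tm S) (q : V) (w : Tm S) (A : Ty S.Ground),
      Thm B ∅ Γ v q w A → Typed Γ v A ∧ Typed Γ w A ∧ M.Satisfies Γ v q w A) ∧
    (∀ Ax : Set (VEquation S B),
      (∀ e ∈ Ax, M.Satisfies e.ctx e.lhs e.label e.rhs e.ty) →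
      ∀ (Γ : Ctx S) (v : Tm S) (q : V) (w : Tm S) (A : Ty S.Ground),
        Thm B Ax Γ v q w A → Typed Γ v A ∧ Typed Γ w A ∧ M.Satisfies Γ v q w A) :=
  ⟨fun _ _ _ _ _ h => Thm.sound integral hB.basis (fun e he => absurd he (Set.notMem_empty e)) h,
    fun _ hAx _ _ _ _ _ h => Thm.sound integral hB.basis hAx h⟩
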